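/- Let $\mathcal{B}$ be the Boolean algebra of clopen subsets of the Cantor set. A submeasure on $\mathcal{B}$ is a map $\nu:\mathcal{B}\to[0,\infty)$ with $\nu(\varnothing)=0$, $\nu(A)\le\nu(B)$ whenever $A\subset B$, and $\nu(A\cup B)\le\nu(A)+\nu(B)$ for all $A,B\in\mathcal{B}$. A (finitely additive) measure on $\mathcal{B}$ is a submeasure $\mu$ such that $\mu(A\cup B)=\mu(A)+\mu(B)$ whenever $A\cap B=\varnothing$. A submeasure $\nu$ is exhaustive if $\lim_{n\to\infty}\nu(E_n)=0$ for every sequence $(E_n)$ of pairwise disjoint elements of $\mathcal{B}$. It is uniformly exhaustive if for every $\varepsilon>0$ there is an integer $n\ge 1$ such that $\min_{i\le n}\nu(E_i)\le\varepsilon$ for all pairwise disjoint $E_1,\dots,E_n\in\mathcal{B}$. A submeasure $\nu_1$ is absolutely continuous with respect to a submeasure $\nu_2$ if for every $\varepsilon>0$ there is $\alpha>0$ such that, for all $A\in\mathcal{B}$, $\nu_2(A)\le\alpha$ implies $\nu_1(A)\le\varepsilon$. **Theorem.** There exists a non-zero exhaustive submeasure $\nu$ on $\mathcal{B}$ that is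 not uniformly exhaustive, and that is not absolutely continuous with respect to any finitely additive measure on $\mathcal{B}$. Moreover, this $\nu$ can be chosen so that in addition no non-zero finitely additive measure $\mu$ on $\mathcal{B}$ is absolutely continuous with respect to $\nu$. In particular Maharam's problem (is every exhaustive submeasure absolutely continuous with respect to a finitely additive measure?) has a negative answer. -/

import Mathlib

open scoped NNReal

namespace Maharam

/-- A submeasure on a Boolean algebra: a monotone, subadditive, non-negative real-valued map
that vanishes at the empty element. -/
structure IsSubmeasure {B : Type*} [BooleanAlgebra B] (ν : B → ℝ≥0) : Prop where
  map_bot : ν ⊥ = 0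
  mono : ∀ A C : B, A ≤ C → ν A ≤ ν C
  subadd : ∀ A C : B, ν (A ⊔ C) ≤ ν A + ν C

/-- A (finitely additive) measure: a submeasure that is additive on disjoint elements. -/
structure IsFinAddMeasure {B : Type*} [BooleanAlgebra B] (μ : B → ℝ≥0) : Prop
    extends IsSubmeasure μ where
  add : ∀ A C : B, Disjoint A C → μ (A ⊔ C) = μ A + μ C

/-- `ν (E n) → 0` along every sequence of pairwise disjoint elements. -/
def IsExhaustive {B : Type*} [BooleanAlgebra B] (ν : B → ℝ≥0) : Prop :=
  ∀ E : ℕ → B, Pairwise (fun i j => Disjoint (E i) (E j)) →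
    Filter.Tendsto (fun n => ν (E n)) Filter.atTop (nhds 0)

/-- For every `ε > 0` there is an `n` such that among any `n` pairwise disjoint elements one has
`ν`-value at most `ε`; that is, the minimum of the `n` values is at most `ε` (`n = 0` never
qualifies). -/
def IsUniformlyExhaustive {B : Type*} [BooleanAlgebra B] (ν : B → ℝ≥0) : Prop :=
  ∀ ε : ℝ≥0, 0 < ε → ∃ n : ℕ, ∀ E : Fin n → B,
    Pairwise (fun i j => Disjoint (E i) (E j)) → ∃ i, ν (E i) ≤ ε

/-- `ν₁` is absolutely continuous with respect to `ν₂`. -/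
def IsAbsolutelyContinuous {B : Type*} [BooleanAlgebra B] (ν₁ ν₂ : B → ℝ≥0) : Prop :=
  ∀ ε : ℝ≥0, 0 < ε → ∃ α : ℝ≥0, 0 < α ∧ ∀ A : B, ν₂ A ≤ α → ν₁ A ≤ ε

end Maharam

/-! The construction follows Talagrand. On the product of the spaces `Fin n → Bool`, the submeasure
of a set is the least weight of a finite cover by marks. A mark is a set `E` with a level `k` and a
finite index set `I`; its weight decreases slowly as `I` grows and is `2⁻ᵏ` when `I` has its largest
size `cap k`. It is admitted only if `E` is thin along `I`: for indices `m < n`, every cylinder of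
length `m` keeps, outside the `n`-hull of `E`, a region that light families of higher-level marks
cannot cover. Admission at level `k` thus depends on the levels above it, so the recursion descends
from a top level `p`, which an ultrafilter limit then removes.

Thinness keeps the values from collapsing (`not_covers_univ_bound`): a mark of lowest level is
eliminated from a cover of the space by rewriting points between two of its indices so that they
dodge it. The other marks lose part of their indices, which costs a small factor in weight. It
follows that every slice `z n = a` has value at least 4 (`four_le_coveringCost_slice`). Disjoint
slices are arbitrarily numerous, so uniform exhaustivity fails; finitely additive measures have it,
and absolute continuity would transfer it.

Exhaustivity (`exists_forall_ge_small`): in a disjoint sequence, the late terms become thin along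
`cap k` indices once a piece of small cost is discarded, so they cost about `2⁻ᵏ`.

Finally, avoiding a fixed point along `cap k` coordinates costs at most `2⁻ᵏ` (`small_avoiding`),
while any finitely additive measure has slices of mass at most `2⁻ⁿ` of the total. Choosing those,
at least half of its mass lies on a cheap set. -/

namespace Maharam

section

variable {X : ℕ → Type}

/-! ### Coordinates, cylinders and hulls. -/

/-- `u` and `v` have the same first `n` coordinates. -/
def Agree (n : ℕ) (u v : ∀ i, X i) : Prop := ∀ i < n, u i = v i

/-- The point with the first `m` coordinates of `a` and the others of `z`. -/
def graft (m : ℕ) (a z : ∀ i, X i) : ∀ i, X i := fun i => if i < m then a i else z i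

/-- The smallest set containing `E` that depends on the first `n` coordinates only. -/
def hull (n : ℕ) (E : Set (∀ i, X i)) : Set (∀ i, X i) := {z | ∃ u ∈ E, Agree n z u}

/-- The set `E` depends on the first `n` coordinates only. -/
def DependsOnFirst (n : ℕ) (E : Set (∀ i, X i)) : Prop := ∀ u v, Agree n u v → u ∈ E → v ∈ E

/-- The set `E` does not depend on the first `m` coordinates. -/
def IgnoresFirst (m : ℕ) (E : Set (∀ i, X i)) : Prop := ∀ a z, graft m a z ∈ E ↔ z ∈ E

theorem Agree.symm {n : ℕ} {u v : ∀ i, X i} (h : Agree n u v) : Agree n v u :=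
  fun i hi => (h i hi).symm

theorem Agree.trans {n : ℕ} {u v w : ∀ i, X i} (h : Agree n u v) (h' : Agree n v w) :
    Agree n u w := fun i hi => (h i hi).trans (h' i hi)

theorem Agree.mono {m n : ℕ} (hmn : m ≤ n) {u v : ∀ i, X i} (h : Agree n u v) : Agree m u v :=
  fun i hi => h i (hi.trans_le hmn)

theorem agree_graft (m : ℕ) (a z : ∀ i, X i) : Agree m (graft m a z) a :=
  fun i hi => by simp [graft, hi]

theorem graft_congr {m : ℕ} {a b : ∀ i, X i} (h : Agree m a b) (z : ∀ i, X i) :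
    graft m a z = graft m b z := by
  funext i
  by_cases hi : i < m <;> simp [graft, hi, h i]

theorem Agree.graft_right {m n : ℕ} {u v : ∀ i, X i} (a : ∀ i, X i) (h : Agree n u v) :
    Agree n (graft m a u) (graft m a v) := by
  intro i hi
  by_cases him : i < m <;> simp [graft, him, h i hi]

theorem hull_anti {m n : ℕ} (h : m ≤ n) (E : Set (∀ i, X i)) : hull n E ⊆ hull m E :=
  fun _ ⟨u, hu, hzu⟩ => ⟨u, hu, hzu.mono h⟩

theorem hull_mono (n : ℕ) {E F : Set (∀ i, X i)} (h : E ⊆ F) : hull n E ⊆ hull n F :=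
  fun _ ⟨u, hu, hzu⟩ => ⟨u, h hu, hzu⟩

theorem dependsOnFirst_hull (n : ℕ) (E : Set (∀ i, X i)) : DependsOnFirst n (hull n E) :=
  fun _ _ huv ⟨w, hw, huw⟩ => ⟨w, hw, huv.symm.trans huw⟩

theorem IgnoresFirst.hull {m : ℕ} (n : ℕ) {E : Set (∀ i, X i)} (h : IgnoresFirst m E) :
    IgnoresFirst m (hull n E) := by
  intro a z
  constructor
  · rintro ⟨u, hu, hzu⟩
    refine ⟨graft m z u, (h z u).2 hu, fun i hi => ?_⟩
    have := hzu i hi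
    by_cases him : i < m <;> simp_all [graft]
  · rintro ⟨u, hu, hzu⟩
    exact ⟨graft m a u, (h a u).2 hu, hzu.graft_right a⟩

theorem ignoresFirst_graft (m : ℕ) (a : ∀ i, X i) (E : Set (∀ i, X i)) :
    IgnoresFirst m {z | graft m a z ∈ E} := by
  intro b z
  have : graft m a (graft m b z) = graft m a z := by
    funext i
    by_cases hi : i < m <;> simp [graft, hi]
  simp [this]

/-! ### Marks and their weights -/

/-- A set with a level and a finite set of indices. -/
structure Mark (X : ℕ → Type) where
  level : ℕ
  idx : Finset ℕ
  carrier : Set (∀ i, X i)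

/-- The exponent at level `k` of the weight function. -/
noncomputable def expo (k : ℕ) : ℝ := ((2 : ℝ) ^ (2 * k + 7))⁻¹

/-- The largest number of indices of a mark of level `k`. -/
def cap (k : ℕ) : ℕ := (2 ^ (k + 8) + 1) * 2 ^ ((k + 5) * 2 ^ (2 * k + 7))

/-- The weight of a mark of level `k` with `j` indices. -/
noncomputable def wt (k j : ℕ) : ℝ := ((2 : ℝ) ^ k)⁻¹ * ((cap k : ℝ) / j) ^ expo k

theorem expo_pos (k : ℕ) : 0 < expo k := by unfold expo; positivity

theorem expo_anti {k l : ℕ} (h : k ≤ l) : expo l ≤ expo k := by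
  unfold expo
  gcongr
  norm_num

theorem expo_le_half (k : ℕ) : expo k ≤ 1 / 2 := by
  refine (expo_anti (Nat.zero_le k)).trans ?_
  norm_num [expo]

theorem cap_pos (k : ℕ) : 0 < cap k := by unfold cap; positivity

theorem wt_nonneg (k j : ℕ) : 0 ≤ wt k j := by unfold wt; positivity

theorem wt_cap (k : ℕ) : wt k (cap k) = ((2 : ℝ) ^ k)⁻¹ := by
  have : (cap k : ℝ) ≠ 0 := by exact_mod_cast (cap_pos k).ne'
  simp [wt, this]

theorem le_wt {k j : ℕ} (hj : 0 < j) (hjk : j ≤ cap k) : ((2 : ℝ) ^ k)⁻¹ ≤ wt k j := by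
  unfold wt
  refine le_mul_of_one_le_right (by positivity) (Real.one_le_rpow ?_ (expo_pos k).le)
  rw [one_le_div (by exact_mod_cast hj)]
  exact_mod_cast hjk

theorem wt_le_mul {k i j L : ℕ} (hi : 0 < i) (hj : 0 < j) (h : j ≤ L * i) :
    wt k i ≤ (L : ℝ) ^ expo k * wt k j := by
  have hi' : (0 : ℝ) < i := by exact_mod_cast hi
  have hj' : (0 : ℝ) < j := by exact_mod_cast hj
  have h' : (j : ℝ) ≤ L * i := by exact_mod_cast h
  have key : (cap k : ℝ) / i ≤ L * (cap k / j) := by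
    rw [div_le_iff₀ hi', mul_div_assoc', div_mul_eq_mul_div, le_div_iff₀ hj']
    nlinarith [(Nat.cast_nonneg (cap k) : (0 : ℝ) ≤ cap k)]
  have := Real.rpow_le_rpow (by positivity) key (expo_pos k).le
  rw [Real.mul_rpow (by positivity) (by positivity)] at this
  unfold wt
  calc _ ≤ ((2 : ℝ) ^ k)⁻¹ * ((L : ℝ) ^ expo k * ((cap k : ℝ) / j) ^ expo k) := by gcongr
    _ = _ := by ring

/-- Hence keeping at least a half or a third of the indices of a mark at most doubles its weight. -/
theorem rpow_expo_le_two {L : ℕ} (hL : 1 ≤ L) (hL' : L ≤ 3) (k : ℕ) : (L : ℝ) ^ expo k ≤ 2 := by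
  have h1 : (1 : ℝ) ≤ L := by exact_mod_cast hL
  have h3 : (L : ℝ) ≤ 3 := by exact_mod_cast hL'
  calc (L : ℝ) ^ expo k ≤ (L : ℝ) ^ (1 / 2 : ℝ) :=
        Real.rpow_le_rpow_of_exponent_le h1 (expo_le_half k)
    _ ≤ (4 : ℝ) ^ (1 / 2 : ℝ) := by gcongr; linarith
    _ = 2 := by
      rw [show (4 : ℝ) = 2 ^ (2 : ℝ) by norm_num, ← Real.rpow_mul (by norm_num)]
      norm_num

/-- The second factor of `cap k` absorbs `(32 * 2 ^ k) ^ (1 / expo k)`; the first is what remains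
for `j`. These indices feed the pigeonhole argument of `exists_cover_erase`. -/
theorem lt_of_wt_le {k j : ℕ} (hj : 0 < j) (h : wt k j ≤ 32) : 2 ^ (k + 8) < j := by
  have hj' : (0 : ℝ) < j := by exact_mod_cast hj
  have h1 : ((cap k : ℝ) / j) ^ expo k ≤ 2 ^ (k + 5) := by
    unfold wt at h
    rw [inv_mul_le_iff₀ (by positivity)] at h
    calc _ ≤ _ := h
      _ = _ := by rw [pow_add]; norm_num
  have h2 : (cap k : ℝ) / j ≤ (2 ^ (k + 5)) ^ (2 ^ (2 * k + 7)) := by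
    have := pow_le_pow_left₀ (by positivity) h1 (2 ^ (2 * k + 7))
    rw [← Real.rpow_natCast, ← Real.rpow_mul (by positivity)] at this
    have he : expo k * ((2 ^ (2 * k + 7) : ℕ) : ℝ) = 1 := by
      unfold expo
      push_cast
      exact inv_mul_cancel₀ (by positivity)
    rwa [he, Real.rpow_one] at this
  rw [div_le_iff₀ hj', ← pow_mul] at h2
  have h3 : cap k ≤ 2 ^ ((k + 5) * 2 ^ (2 * k + 7)) * j := by exact_mod_cast h2
  unfold cap at h3
  rw [mul_comm] at h3
  exact Nat.le_of_mul_le_mul_left h3 (by positivity)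

/-- The weight of a mark. -/
noncomputable def Mark.weight (x : Mark X) : ℝ := wt x.level x.idx.card

/-- Finitely many marks of `𝒞` of total weight at most `c` cover `A`. -/
def Covers (𝒞 : Set (Mark X)) (A : Set (∀ i, X i)) (c : ℝ) : Prop :=
  ∃ (ι : Type) (s : Finset ι) (x : ι → Mark X), (∀ i ∈ s, x i ∈ 𝒞) ∧
    (∀ z ∈ A, ∃ i ∈ s, z ∈ (x i).carrier) ∧ ∑ i ∈ s, (x i).weight ≤ c

theorem Covers.mono {𝒞 𝒟 : Set (Mark X)} {A B : Set (∀ i, X i)} {c d : ℝ} (h : Covers 𝒞 A c)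
    (h𝒞 : 𝒞 ⊆ 𝒟) (hA : B ⊆ A) (hc : c ≤ d) : Covers 𝒟 B d := by
  obtain ⟨ι, s, x, hx, hcov, hw⟩ := h
  exact ⟨ι, s, x, fun i hi => h𝒞 (hx i hi), fun z hz => hcov z (hA hz), hw.trans hc⟩

theorem covers_empty (𝒞 : Set (Mark X)) {c : ℝ} (hc : 0 ≤ c) : Covers 𝒞 ∅ c :=
  ⟨ℕ, ∅, fun _ => ⟨0, ∅, ∅⟩, by simp, by simp, by simpa⟩

theorem Covers.union {𝒞 : Set (Mark X)} {A B : Set (∀ i, X i)} {c d : ℝ} (hA : Covers 𝒞 A c)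
    (hB : Covers 𝒞 B d) : Covers 𝒞 (A ∪ B) (c + d) := by
  obtain ⟨ι, s, x, hx, hcov, hw⟩ := hA
  obtain ⟨κ, t, y, hy, hcov', hw'⟩ := hB
  refine ⟨ι ⊕ κ, s.disjSum t, Sum.elim x y, ?_, ?_, ?_⟩
  · rintro (i | i) hi <;> simp_all
  · rintro z (hz | hz)
    · obtain ⟨i, hi, hzi⟩ := hcov z hz
      exact ⟨Sum.inl i, by simpa, hzi⟩
    · obtain ⟨i, hi, hzi⟩ := hcov' z hz
      exact ⟨Sum.inr i, by simpa, hzi⟩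
  · rw [Finset.sum_disjSum]
    simpa using add_le_add hw hw'

theorem covers_singleton {𝒞 : Set (Mark X)} {x : Mark X} (hx : x ∈ 𝒞) :
    Covers 𝒞 x.carrier x.weight :=
  ⟨Unit, {()}, fun _ => x, by simpa, by simp, by simp⟩

/-! ### Thin sets, admissible marks and the operations preserving them. -/

/-- `E` is thin along `I` with respect to `𝒞`: for `m < n` in `I`, inside each cylinder of length
`m`, the complement of the `n`-hull of `E` is hard to cover. -/
def Thin (𝒞 : Set (Mark X)) (I : Finset ℕ) (E : Set (∀ i, X i)) : Prop :=
  ∀ m ∈ I, ∀ n ∈ I, m < n → ∀ a, ¬ Covers 𝒞 {z | graft m a z ∉ hull n E} 1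

/-- The marks of levels `k, …, k + d - 1`. -/
def cls (X : ℕ → Type) : ℕ → ℕ → Set (Mark X)
  | 0, _ => ∅
  | d + 1, k => cls X d (k + 1) ∪ {x | x.level = k ∧ x.idx.Nonempty ∧ x.idx.card ≤ cap k ∧
      Thin (cls X d (k + 1)) x.idx x.carrier}

/-- Along `I`, thinness passes from `E` to `F`. -/
def Reduces (I : Finset ℕ) (E F : Set (∀ i, X i)) : Prop :=
  ∀ m ∈ I, ∀ n ∈ I, m < n → ∀ a, ∃ b, ∀ z, graft m a z ∈ hull n F → graft m b z ∈ hull n E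

theorem Thin.reduces {𝒞 : Set (Mark X)} {I J : Finset ℕ} {E F : Set (∀ i, X i)}
    (h : Thin 𝒞 I E) (hJ : J ⊆ I) (hr : Reduces J E F) : Thin 𝒞 J F := by
  intro m hm n hn hmn a hcov
  obtain ⟨b, hb⟩ := hr m hm n hn hmn a
  exact h m (hJ hm) n (hJ hn) hmn b
    (hcov.mono subset_rfl (fun z hz hz' => hz (hb z hz')) le_rfl)

/-- This is how new marks are made from old ones. Nonemptiness of `J` matters: without indices a
mark would be vacuously thin and, division by zero being zero, weightless. -/
theorem mem_cls_of_reduces {d k : ℕ} {x : Mark X} (hx : x ∈ cls X d k) {J : Finset ℕ}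
    (hJ : J ⊆ x.idx) (hJ' : J.Nonempty) {F : Set (∀ i, X i)} (hr : Reduces J x.carrier F) :
    (⟨x.level, J, F⟩ : Mark X) ∈ cls X d k := by
  induction d generalizing k with
  | zero => exact hx.elim
  | succ d ih =>
    rcases hx with hx | ⟨h1, -, h3, h4⟩
    · exact Or.inl (ih hx)
    · exact Or.inr ⟨h1, hJ', (Finset.card_le_card hJ).trans h3, h4.reduces hJ hr⟩

theorem cls_spec {d k : ℕ} {x : Mark X} (hx : x ∈ cls X d k) :
    k ≤ x.level ∧ 0 < x.idx.card ∧ x.idx.card ≤ cap x.level := by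
  induction d generalizing k with
  | zero => exact hx.elim
  | succ d ih =>
    rcases hx with hx | ⟨h1, h2, h3, -⟩
    · obtain ⟨h1, h2⟩ := ih hx
      exact ⟨by omega, h2⟩
    · exact ⟨h1.ge, h2.card_pos, h1 ▸ h3⟩

theorem le_weight {d k : ℕ} {x : Mark X} (hx : x ∈ cls X d k) :
    ((2 : ℝ) ^ x.level)⁻¹ ≤ x.weight := le_wt (cls_spec hx).2.1 (cls_spec hx).2.2

theorem Mark.weight_nonneg (x : Mark X) : 0 ≤ x.weight := wt_nonneg _ _

theorem Reduces.trans {I : Finset ℕ} {E F G : Set (∀ i, X i)} (h : Reduces I E F)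
    (h' : Reduces I F G) : Reduces I E G := by
  intro m hm n hn hmn a
  obtain ⟨b, hb⟩ := h' m hm n hn hmn a
  obtain ⟨c, hc⟩ := h m hm n hn hmn b
  exact ⟨c, fun z hz => hc z (hb z hz)⟩

theorem reduces_hull {I : Finset ℕ} {n : ℕ} (hI : ∀ i ∈ I, i ≤ n) (E : Set (∀ i, X i)) :
    Reduces I E (hull n E) := by
  intro m _ n' hn' _ a
  refine ⟨a, fun z => ?_⟩
  rintro ⟨u, ⟨v, hv, huv⟩, hzu⟩
  exact ⟨v, hv, hzu.trans (huv.mono (hI n' hn'))⟩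

/-- It is used for maps that carry each cylinder of length `m` into one and leave the coordinates
from `m` to `n` unchanged. -/
theorem reduces_preimage {I : Finset ℕ} (Φ : (∀ i, X i) → ∀ i, X i)
    (hΦ : ∀ m ∈ I, ∀ n ∈ I, m < n → ∀ a, ∃ b, ∀ z u, Agree n u (graft m a z) →
      Agree n (Φ u) (graft m b z)) (E : Set (∀ i, X i)) : Reduces I E (Φ ⁻¹' E) := by
  intro m hm n hn hmn a
  obtain ⟨b, hb⟩ := hΦ m hm n hn hmn a
  refine ⟨b, fun z => ?_⟩
  rintro ⟨u, hu, hzu⟩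
  exact ⟨Φ u, hu, (hb z u hzu.symm).symm⟩

theorem reduces_graft {I : Finset ℕ} {m : ℕ} (hI : ∀ i ∈ I, m ≤ i) (a : ∀ i, X i)
    (E : Set (∀ i, X i)) : Reduces I E {z | graft m a z ∈ E} := by
  refine reduces_preimage (graft m a)
    (fun m' hm' n' _ _ b => ⟨graft m a b, fun z u hu i hi => ?_⟩) E
  have h2 := hu i hi
  have := hI m' hm'
  by_cases h1 : i < m
  · simp [graft, h1, h1.trans_le this]
  · simpa [graft, h1] using h2

/-- Replace the coordinates of `z` in `[m, n)` by those of `g z`. -/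
def splice (m n : ℕ) (g : (∀ i, X i) → ∀ i, X i) (z : ∀ i, X i) : ∀ i, X i :=
  fun i => if m ≤ i ∧ i < n then g z i else z i

theorem reduces_splice_of_le {I : Finset ℕ} {m n : ℕ} (hI : ∀ i ∈ I, i ≤ m)
    (g : (∀ i, X i) → ∀ i, X i) (E : Set (∀ i, X i)) : Reduces I E (splice m n g ⁻¹' E) := by
  refine reduces_preimage _ (fun m' _ n' hn' _ a => ⟨a, fun z u hu i hi => ?_⟩) E
  have h := hI n' hn'
  have : ¬ (m ≤ i ∧ i < n) := by omega
  rw [← hu i hi]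
  simp only [splice, this, if_false]

theorem reduces_splice_of_ge {I : Finset ℕ} {m n : ℕ} (hmn : m ≤ n) (hI : ∀ i ∈ I, n ≤ i)
    {g : (∀ i, X i) → ∀ i, X i} (hg : ∀ u v, Agree m u v → g u = g v) (E : Set (∀ i, X i)) :
    Reduces I E (splice m n g ⁻¹' E) := by
  refine reduces_preimage _ (fun m' hm' n' _ hmn' a => ⟨splice m n g a, fun z u hu i hi => ?_⟩) E
  have h := hI m' hm'
  have hgu : g u = g a := hg u a ((hu.mono hmn'.le).trans (agree_graft m' a z) |>.mono (by omega))
  have hi' := hu i hi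
  by_cases h1 : m ≤ i ∧ i < n
  · have : i < m' := by omega
    simp [splice, graft, h1, this, hgu]
  · simp only [splice, graft, h1, if_false] at hi' ⊢
    exact hi'

end

/-! ### Light families of marks do not cover the space. -/

section

variable {X : ℕ → Type}

/-- Otherwise `f` would rise by more than `δ` between consecutive elements of `I`, hence by at least
`t * δ > W` in all. -/
theorem exists_lt_sub_le {f : ℕ → ℝ} (hf : ∀ n, 0 ≤ f n) {W δ : ℝ} (hW : ∀ n, f n ≤ W) {t : ℕ}
    (ht : W < t * δ) {I : Finset ℕ} (hI : t < I.card) :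
    ∃ m ∈ I, ∃ n ∈ I, m < n ∧ f n - f m ≤ δ := by
  by_contra! hcon
  have hδ : 0 ≤ δ := by
    by_contra! h
    nlinarith [hf 0, hW 0, (Nat.cast_nonneg t : (0 : ℝ) ≤ t)]
  have key : ∀ J : Finset ℕ, (∀ m ∈ J, ∀ n ∈ J, m < n → δ < f n - f m) → J.Nonempty →
      ∃ n ∈ J, ((J.card : ℝ) - 1) * δ ≤ f n := by
    intro J
    induction J using Finset.induction_on_max with
    | empty => simp
    | insert a s hs ih =>
      intro hgap _
      have ha : a ∉ s := fun h => (hs a h).false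
      refine ⟨a, by simp, ?_⟩
      rw [Finset.card_insert_of_notMem ha]
      rcases s.eq_empty_or_nonempty with rfl | hne
      · simpa using hf a
      · obtain ⟨n, hn, hle⟩ := ih (fun m hm n hn => hgap m (by simp [hm]) n (by simp [hn])) hne
        have := hgap n (by simp [hn]) a (by simp) (hs n hn)
        push_cast
        linarith
  obtain ⟨n, -, hle⟩ := key I hcon (Finset.card_pos.1 (by omega))
  have : (t : ℝ) + 1 ≤ I.card := by exact_mod_cast hI
  nlinarith [hW n]

/-- A weighted family of finite sets of integers has little mass in some interval between two
elements of a large set `I`. -/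
theorem exists_interval_sum_le {ι : Type} (s : Finset ι) (w : ι → ℝ) (hw : ∀ i ∈ s, 0 ≤ w i)
    (J : ι → Finset ℕ) {δ : ℝ} {t : ℕ} (ht : ∑ i ∈ s, w i < t * δ) {I : Finset ℕ}
    (hI : t < I.card) : ∃ m ∈ I, ∃ n ∈ I, m < n ∧
      ∑ i ∈ s, w i * ((((J i).filter fun l => m ≤ l ∧ l < n).card : ℝ) / (J i).card) ≤ δ := by
  obtain ⟨m, hm, n, hn, hmn, h⟩ := exists_lt_sub_le
    (f := fun n => ∑ i ∈ s, w i * ((((J i).filter fun l => l < n).card : ℝ) / (J i).card))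
    (fun n => Finset.sum_nonneg fun i hi => mul_nonneg (hw i hi) (by positivity))
    (fun n => Finset.sum_le_sum fun i hi => mul_le_of_le_one_right (hw i hi)
      (div_le_one_of_le₀ (by exact_mod_cast Finset.card_filter_le _ _) (by positivity))) ht hI
  refine ⟨m, hm, n, hn, hmn, le_of_eq_of_le ?_ h⟩
  rw [← Finset.sum_sub_distrib]
  refine Finset.sum_congr rfl fun i _ => ?_
  rw [← mul_sub, ← sub_div]
  congr 2
  rw [eq_sub_iff_add_eq, ← Nat.cast_add, ← Finset.card_union_of_disjoint]
  · congr 2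
    ext l
    simp only [Finset.mem_union, Finset.mem_filter]
    constructor
    · rintro (h | h)
      · exact ⟨h.1, h.2.2⟩
      · exact ⟨h.1, h.2.trans hmn⟩
    · intro h
      by_cases hl : l < m
      · exact Or.inr ⟨h.1, hl⟩
      · exact Or.inl ⟨h.1, not_lt.1 hl, h.2⟩
  · rw [Finset.disjoint_filter]
    intro l _ h h'
    omega

theorem weight_restrict_le {d k : ℕ} {x : Mark X} (hx : x ∈ cls X d k) {J : Finset ℕ} {L : ℕ}
    (h : x.idx.card ≤ L * J.card) :
    wt x.level J.card ≤ (L : ℝ) ^ expo x.level * x.weight := by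
  have h0 := (cls_spec hx).2.1
  exact wt_le_mul (Nat.pos_of_ne_zero fun hJ => by simp [hJ] at h; simp [h] at h0) h0 h

variable [∀ n, Nonempty (X n)]

/-- One step of the elimination of the marks of lowest level: if the marks of a family in
`cls X (d + 1) k` of weight at most `32` cover the space and `y` is one of them of level `k`, then
there is a similar family without `y`. -/
theorem exists_cover_erase {d k : ℕ} {ι : Type} [DecidableEq ι] {s : Finset ι} {x : ι → Mark X}
    (hx : ∀ i ∈ s, x i ∈ cls X (d + 1) k) (hw : ∑ i ∈ s, (x i).weight ≤ 32)
    (hcov : ∀ z, ∃ i ∈ s, z ∈ (x i).carrier) {y : ι} (hy : y ∈ s) (hyk : (x y).level = k) :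
    ∃ (r : Finset ι) (x' : ι → Mark X), r ⊆ s.erase y ∧ (∀ i ∈ r, x' i ∈ cls X (d + 1) k) ∧
      (∀ i ∈ r, (x' i).level = (x i).level) ∧ (∀ z, ∃ i ∈ r, z ∈ (x' i).carrier) ∧
      ∑ i ∈ r, (x' i).weight ≤ (3 : ℝ) ^ expo k * ∑ i ∈ s, (x i).weight := by
  have hthin : Thin (cls X d (k + 1)) (x y).idx (x y).carrier := by
    rcases hx y hy with h | h
    · have := (cls_spec h).1
      omega
    · exact h.2.2.2
  have hcard : 2 ^ (k + 8) < (x y).idx.card := by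
    have h1 := lt_of_wt_le (k := (x y).level) (cls_spec (hx y hy)).2.1
      ((Finset.single_le_sum (f := fun i => (x i).weight) (fun i _ => (x i).weight_nonneg) hy).trans
        hw)
    rwa [hyk] at h1
  have hsum : ∑ i ∈ s.erase y, (x i).weight ≤ ∑ i ∈ s, (x i).weight :=
    Finset.sum_le_sum_of_subset_of_nonneg (Finset.erase_subset _ _)
      fun i _ _ => (x i).weight_nonneg
  have hk0 : (0 : ℝ) < 2 ^ k := by positivity
  -- Here `t * δ = 256 / 6`, which exceeds the total weight 32.
  obtain ⟨m, hm, n, hn, hmn, hδ⟩ := exists_interval_sum_le (s.erase y) (fun i => (x i).weight)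
    (fun i _ => (x i).weight_nonneg) (fun i => (x i).idx) (δ := ((2 : ℝ) ^ k)⁻¹ / 6)
    (t := 2 ^ (k + 8)) (by
      refine (hsum.trans hw).trans_lt ?_
      push_cast
      rw [pow_add]
      have : (2 : ℝ) ^ k * (2 ^ k)⁻¹ = 1 := mul_inv_cancel₀ hk0.ne'
      nlinarith) hcard
  let mi : ι → Finset ℕ := fun i => (x i).idx.filter fun l => m ≤ l ∧ l < n
  let lo : ι → Finset ℕ := fun i => (x i).idx.filter fun l => l < m
  let up : ι → Finset ℕ := fun i => (x i).idx.filter fun l => n ≤ l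
  have hsplit : ∀ i, (x i).idx.card ≤ (lo i).card + (mi i).card + (up i).card := by
    intro i
    refine (Finset.card_le_card ?_).trans ((Finset.card_union_le _ _).trans
      (Nat.add_le_add_right (Finset.card_union_le _ _) _))
    intro l hl
    simp only [lo, mi, up, Finset.mem_union, Finset.mem_filter, hl, true_and]
    omega
  let M := (s.erase y).filter fun i => (x i).idx.card ≤ 3 * (mi i).card
  let r := (s.erase y).filter fun i => ¬ (x i).idx.card ≤ 3 * (mi i).card
  have hMs : ∀ i ∈ M, i ∈ s := fun i hi => Finset.mem_of_mem_erase (Finset.mem_filter.1 hi).1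
  have hrs : ∀ i ∈ r, i ∈ s := fun i hi => Finset.mem_of_mem_erase (Finset.mem_filter.1 hi).1
  have hMw : ∑ i ∈ M, (x i).weight ≤ ((2 : ℝ) ^ k)⁻¹ / 2 := by
    calc ∑ i ∈ M, (x i).weight
        ≤ ∑ i ∈ M, 3 * ((x i).weight * (((mi i).card : ℝ) / (x i).idx.card)) := by
          refine Finset.sum_le_sum fun i hi => ?_
          have h0 : (0 : ℝ) < (x i).idx.card := by
            exact_mod_cast (cls_spec (hx i (hMs i hi))).2.1
          have h3 : ((x i).idx.card : ℝ) ≤ 3 * (mi i).card := by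
            exact_mod_cast (Finset.mem_filter.1 hi).2
          have h1 : (1 : ℝ) ≤ 3 * (((mi i).card : ℝ) / (x i).idx.card) := by
            rw [← mul_div_assoc, one_le_div h0]
            exact h3
          nlinarith [(x i).weight_nonneg]
      _ ≤ ∑ i ∈ s.erase y, 3 * ((x i).weight * (((mi i).card : ℝ) / (x i).idx.card)) :=
          Finset.sum_le_sum_of_subset_of_nonneg (Finset.filter_subset _ _) fun i _ _ =>
            mul_nonneg (by norm_num) (mul_nonneg (x i).weight_nonneg (by positivity))
      _ ≤ ((2 : ℝ) ^ k)⁻¹ / 2 := by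
          rw [← Finset.mul_sum]
          linarith
  -- A mark of level `k` weighs at least `2⁻ᵏ`, more than the whole of `M`. So `M` has higher level
  -- and thinness of `x y` applies to it.
  have hM : ∀ i ∈ M, x i ∈ cls X d (k + 1) := by
    intro i hi
    rcases hx i (hMs i hi) with h | h
    · exact h
    · exfalso
      have h1 := le_weight (hx i (hMs i hi))
      have h2 := Finset.single_le_sum (f := fun i => (x i).weight)
        (fun i _ => (x i).weight_nonneg) hi
      rw [h.1] at h1
      have h3 : (0 : ℝ) < ((2 : ℝ) ^ k)⁻¹ := by positivity
      linarith
  -- Otherwise the marks of `M`, cut down to their indices in `[m, n)`, would cover at cost at most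
  -- 1 the region that thinness of `x y` protects.
  have hpick : ∀ a, ∃ z, graft m a z ∉ hull n (x y).carrier ∧
      ∀ i ∈ M, graft m a z ∉ hull n (x i).carrier := by
    intro a
    by_contra! hcon
    refine hthin m hm n hn hmn a ⟨ι, M, fun i => ⟨(x i).level, mi i,
      {z | graft m a z ∈ hull n (x i).carrier}⟩, fun i hi => ?_, fun z hz => hcon z hz, ?_⟩
    · have hpos := (cls_spec (hM i hi)).2.1
      have hle := (Finset.mem_filter.1 hi).2
      refine mem_cls_of_reduces (hM i hi) (Finset.filter_subset _ _)
        (Finset.card_pos.1 (Nat.pos_of_mul_pos_left (hpos.trans_le hle)))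
        (Reduces.trans (reduces_hull (n := n) ?_ _) (reduces_graft ?_ _ _))
      · intro l hl
        exact (Finset.mem_filter.1 hl).2.2.le
      · intro l hl
        exact (Finset.mem_filter.1 hl).2.1
    · calc ∑ i ∈ M, wt (x i).level (mi i).card ≤ ∑ i ∈ M, 2 * (x i).weight := by
            refine Finset.sum_le_sum fun i hi => ?_
            refine (weight_restrict_le (hM i hi) (Finset.mem_filter.1 hi).2).trans ?_
            gcongr
            · exact (x i).weight_nonneg
            · exact rpow_expo_le_two (by norm_num) le_rfl _
        _ ≤ 1 := by
            rw [← Finset.mul_sum]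
            have : ((2 : ℝ) ^ k)⁻¹ ≤ 1 := inv_le_one_of_one_le₀ (one_le_pow₀ (by norm_num))
            linarith
  choose f hf using hpick
  let p : ∀ i, X i := fun i => Classical.arbitrary (X i)
  -- Filling in with `p` makes the choice depend on the first `m` coordinates only, as pulling back
  -- marks along the splice requires.
  let g : (∀ i, X i) → ∀ i, X i := fun z => f (graft m z p)
  have hg : ∀ u v, Agree m u v → g u = g v := fun u v h => by simp only [g, graft_congr h]
  have hagree : ∀ z, Agree n (graft m (graft m z p) (g z)) (splice m n g z) := by
    intro z l hl
    by_cases h : l < m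
    · simp [splice, graft, h]
    · simp [splice, graft, h, hl, not_lt.1 h]
  have havoid : ∀ z E, graft m (graft m z p) (g z) ∉ hull n E → splice m n g z ∉ E :=
    fun z E h h' => h ⟨_, h', hagree z⟩
  -- A mark of `r` has less than a third of its indices in `[m, n)`, so at least a third lie on one
  -- side.
  let J : ι → Finset ℕ := fun i => if (x i).idx.card ≤ 3 * (lo i).card then lo i else up i
  have hJ : ∀ i ∈ r, (x i).idx.card ≤ 3 * (J i).card := by
    intro i hi
    have h1 := (Finset.mem_filter.1 hi).2
    have h2 := hsplit i
    by_cases h : (x i).idx.card ≤ 3 * (lo i).card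
    · simp only [J, h, if_true]
    · simp only [J, h, if_false]
      omega
  refine ⟨r, fun i => ⟨(x i).level, J i, splice m n g ⁻¹' (x i).carrier⟩, Finset.filter_subset _ _,
    fun i hi => ?_, fun i _ => rfl, fun z => ?_, ?_⟩
  · have hpos := (cls_spec (hx i (hrs i hi))).2.1
    have hJi := hJ i hi
    have hne : (J i).Nonempty := Finset.card_pos.1 (by omega)
    by_cases h : (x i).idx.card ≤ 3 * (lo i).card
    · have hJlo : J i = lo i := if_pos h
      rw [hJlo] at hne
      change (⟨_, J i, _⟩ : Mark X) ∈ _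
      rw [hJlo]
      exact mem_cls_of_reduces (hx i (hrs i hi)) (Finset.filter_subset _ _) hne
        (reduces_splice_of_le (fun l hl => (Finset.mem_filter.1 hl).2.le) g _)
    · have hJhi : J i = up i := if_neg h
      rw [hJhi] at hne
      change (⟨_, J i, _⟩ : Mark X) ∈ _
      rw [hJhi]
      exact mem_cls_of_reduces (hx i (hrs i hi)) (Finset.filter_subset _ _) hne
        (reduces_splice_of_ge hmn.le (fun l hl => (Finset.mem_filter.1 hl).2) hg _)
  · obtain ⟨i, hi, hz⟩ := hcov (splice m n g z)
    refine ⟨i, Finset.mem_filter.2 ⟨Finset.mem_erase.2 ⟨?_, hi⟩, fun h => ?_⟩, hz⟩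
    · rintro rfl
      exact havoid z _ (hf _).1 hz
    · by_cases hiy : i = y
      · exact havoid z _ (hf _).1 (hiy ▸ hz)
      · exact havoid z _ ((hf _).2 i (Finset.mem_filter.2 ⟨Finset.mem_erase.2 ⟨hiy, hi⟩, h⟩)) hz
  · calc ∑ i ∈ r, wt (x i).level (J i).card
        ≤ ∑ i ∈ r, (3 : ℝ) ^ expo k * (x i).weight := by
          refine Finset.sum_le_sum fun i hi => ?_
          refine (weight_restrict_le (hx i (hrs i hi)) (hJ i hi)).trans ?_
          gcongr
          · exact (x i).weight_nonneg
          · exact_mod_cast Real.rpow_le_rpow_of_exponent_le (by norm_num : (1 : ℝ) ≤ 3)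
              (expo_anti (cls_spec (hx i (hrs i hi))).1)
      _ ≤ _ := by
          rw [← Finset.mul_sum]
          refine mul_le_mul_of_nonneg_left ?_ (by positivity)
          exact (Finset.sum_le_sum_of_subset_of_nonneg (Finset.filter_subset _ _)
            fun i _ _ => (x i).weight_nonneg).trans hsum

/-- Each elimination costs a factor `3 ^ expo k`; once no mark of level `k` is left, the family lies
in the next class. -/
theorem not_cover_succ {d k : ℕ} {c : ℝ} (hc : c ≤ 32)
    (hd : ¬ Covers (cls X d (k + 1)) Set.univ c) (j : ℕ) {ι : Type} {s : Finset ι}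
    {x : ι → Mark X} (hx : ∀ i ∈ s, x i ∈ cls X (d + 1) k)
    (hj : (s.filter fun i => (x i).level = k).card ≤ j)
    (hw : ((3 : ℝ) ^ expo k) ^ j * ∑ i ∈ s, (x i).weight ≤ c) :
    ¬ ∀ z, ∃ i ∈ s, z ∈ (x i).carrier := by
  classical
  intro hcov
  have hq : (1 : ℝ) ≤ 3 ^ expo k := Real.one_le_rpow (by norm_num) (expo_pos k).le
  induction j generalizing s x with
  | zero =>
    rw [Nat.le_zero, Finset.card_eq_zero, Finset.filter_eq_empty_iff] at hj
    exact hd ⟨ι, s, x, fun i hi => (hx i hi).resolve_right fun h => hj hi h.1,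
      fun z _ => hcov z, by simpa using hw⟩
  | succ j ih =>
    have h0 : 0 ≤ ∑ i ∈ s, (x i).weight := Finset.sum_nonneg fun i _ => (x i).weight_nonneg
    by_cases hy : ∃ y ∈ s, (x y).level = k
    · obtain ⟨y, hy, hyk⟩ := hy
      have hw' : ∑ i ∈ s, (x i).weight ≤ 32 := by
        have : (1 : ℝ) ≤ (3 ^ expo k) ^ (j + 1) := one_le_pow₀ hq
        nlinarith
      obtain ⟨r, x', hr, hx', hlev, hcov', hsum⟩ := exists_cover_erase hx hw' hcov hy hyk
      refine ih hx' ?_ ?_ hcov'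
      · have : (r.filter fun i => (x' i).level = k) ⊆
            (s.filter fun i => (x i).level = k).erase y := by
          intro i hi
          obtain ⟨hi, hik⟩ := Finset.mem_filter.1 hi
          rw [hlev i hi] at hik
          have := Finset.mem_erase.1 (hr hi)
          exact Finset.mem_erase.2 ⟨this.1, Finset.mem_filter.2 ⟨this.2, hik⟩⟩
        have h1 := Finset.card_le_card this
        rw [Finset.card_erase_of_mem (by simp [hy, hyk])] at h1
        omega
      · refine le_trans ?_ hw
        rw [pow_succ, mul_assoc]
        gcongr
    · refine ih hx ?_ (le_trans ?_ hw) hcov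
      · rw [Finset.card_eq_zero.2 (Finset.filter_eq_empty_iff.2 fun i hi h => hy ⟨i, hi, h⟩)]
        exact Nat.zero_le _
      · exact mul_le_mul_of_nonneg_right (pow_le_pow_right₀ hq (Nat.le_succ j)) h0

/-- The total weight below which marks of level at least `k` do not cover the space. -/
noncomputable def bound (k : ℕ) : ℝ := 2 ^ (5 - ((2 : ℝ) ^ k)⁻¹)

theorem bound_le (k : ℕ) : bound k ≤ 32 := by
  calc bound k ≤ (2 : ℝ) ^ (5 : ℝ) :=
        Real.rpow_le_rpow_of_exponent_le (by norm_num) (sub_le_self _ (by positivity))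
    _ = 32 := by norm_num

theorem le_bound (k : ℕ) : 16 ≤ bound k := by
  have : ((2 : ℝ) ^ k)⁻¹ ≤ 1 := inv_le_one_of_one_le₀ (one_le_pow₀ (by norm_num))
  calc (16 : ℝ) = 2 ^ (4 : ℝ) := by norm_num
    _ ≤ bound k := Real.rpow_le_rpow_of_exponent_le (by norm_num) (by linarith)

/-- The accumulated factor is `3 ^ 2⁻⁽ᵏ⁺²⁾ ≤ 2 ^ 2⁻⁽ᵏ⁺¹⁾`, exactly the growth of `bound` from `k` to
`k + 1`. -/
theorem mul_bound_le (k : ℕ) : ((3 : ℝ) ^ expo k) ^ (2 ^ (k + 5)) * bound k ≤ bound (k + 1) := by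
  have h : expo k * ((2 ^ (k + 5) : ℕ) : ℝ) = ((2 : ℝ) ^ (k + 2))⁻¹ := by
    unfold expo
    rw [inv_mul_eq_iff_eq_mul₀ (by positivity), eq_comm, mul_inv_eq_iff_eq_mul₀ (by positivity)]
    push_cast
    rw [← pow_add]
    congr 1
    omega
  have h4 : (3 : ℝ) ^ ((2 : ℝ) ^ (k + 2))⁻¹ ≤ 2 ^ ((2 : ℝ) ^ (k + 1))⁻¹ := by
    calc (3 : ℝ) ^ ((2 : ℝ) ^ (k + 2))⁻¹ ≤ 4 ^ ((2 : ℝ) ^ (k + 2))⁻¹ := by gcongr; norm_num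
      _ = _ := by
        rw [show (4 : ℝ) = 2 ^ (2 : ℝ) by norm_num, ← Real.rpow_mul (by norm_num)]
        congr 1
        rw [pow_succ 2 (k + 1)]
        field_simp
  rw [← Real.rpow_natCast, ← Real.rpow_mul (by norm_num), h]
  calc _ ≤ (2 : ℝ) ^ ((2 : ℝ) ^ (k + 1))⁻¹ * bound k := by
        gcongr
        exact (by norm_num : (0 : ℝ) ≤ 16).trans (le_bound k)
    _ = bound (k + 1) := by
        unfold bound
        rw [← Real.rpow_add (by norm_num)]
        congr 1
        rw [pow_succ]
        field_simp
        ring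

/-- Marks of level `k` weigh at least `2⁻ᵏ`, so a family of weight at most 32 has at most `2 ^ (k +
5)` of them to eliminate. -/
theorem not_covers_univ_bound (d k : ℕ) : ¬ Covers (cls X d k) Set.univ (bound k) := by
  induction d generalizing k with
  | zero =>
    rintro ⟨ι, s, x, hx, hcov, -⟩
    obtain ⟨i, hi, -⟩ := hcov (fun i => Classical.arbitrary (X i)) trivial
    exact hx i hi
  | succ d ih =>
    rintro ⟨ι, s, x, hx, hcov, hw⟩
    refine not_cover_succ (bound_le (k + 1)) (ih (k + 1)) (2 ^ (k + 5)) hx ?_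
      (le_trans ?_ (mul_bound_le k)) (fun z => hcov z trivial)
    · have h1 : ((s.filter fun i => (x i).level = k).card : ℝ) * ((2 : ℝ) ^ k)⁻¹ ≤ 32 := by
        rw [← nsmul_eq_mul]
        refine (Finset.card_nsmul_le_sum _ (fun i => (x i).weight) _ fun i hi => ?_).trans
          ((Finset.sum_le_sum_of_subset_of_nonneg (Finset.filter_subset _ _)
            fun i _ _ => (x i).weight_nonneg).trans (hw.trans (bound_le k)))
        obtain ⟨hi, hik⟩ := Finset.mem_filter.1 hi
        have := le_weight (hx i hi)
        rwa [hik] at this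
      rw [mul_inv_le_iff₀ (by positivity)] at h1
      have h2 : ((s.filter fun i => (x i).level = k).card : ℝ) ≤ ((2 ^ (k + 5) : ℕ) : ℝ) := by
        push_cast
        rw [pow_add]
        linarith
      exact_mod_cast h2
    · gcongr

theorem not_covers_univ (d k : ℕ) {c : ℝ} (hc : c ≤ 16) : ¬ Covers (cls X d k) Set.univ c :=
  fun h => not_covers_univ_bound d k (h.mono subset_rfl subset_rfl (hc.trans (le_bound k)))

/-- Overwriting coordinate `n` by `a` maps the space into the slice. Pulled back, each mark keeps
the half of its indices on one side of that coordinate, so weights at most double. -/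
theorem not_covers_slice (d k n : ℕ) (a : X n) {c : ℝ} (hc : c ≤ 8) :
    ¬ Covers (cls X d k) {z | z n = a} c := by
  classical
  rintro ⟨ι, s, x, hx, hcov, hw⟩
  let g : (∀ i, X i) → ∀ i, X i := fun _ => Function.update (fun i => Classical.arbitrary (X i)) n a
  let lo : ι → Finset ℕ := fun i => (x i).idx.filter fun l => l < n + 1
  let up : ι → Finset ℕ := fun i => (x i).idx.filter fun l => ¬ l < n + 1
  have hsplit : ∀ i, (lo i).card + (up i).card = (x i).idx.card := fun i =>
    Finset.card_filter_add_card_filter_not _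
  let J : ι → Finset ℕ := fun i => if (x i).idx.card ≤ 2 * (lo i).card then lo i else up i
  have hJ : ∀ i, (x i).idx.card ≤ 2 * (J i).card := by
    intro i
    have h2 := hsplit i
    by_cases h : (x i).idx.card ≤ 2 * (lo i).card
    · simp only [J, h, if_true]
    · simp only [J, h, if_false]
      omega
  refine not_covers_univ d k (c := 2 * c) (by linarith) ⟨ι, s, fun i => ⟨(x i).level, J i,
    splice n (n + 1) g ⁻¹' (x i).carrier⟩, fun i hi' => ?_, fun z _ => ?_, ?_⟩
  · have hpos := (cls_spec (hx i hi')).2.1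
    have hJi := hJ i
    have hne : (J i).Nonempty := Finset.card_pos.1 (by omega)
    by_cases h : (x i).idx.card ≤ 2 * (lo i).card
    · have hJlo : J i = lo i := if_pos h
      rw [hJlo] at hne
      change (⟨_, J i, _⟩ : Mark X) ∈ _
      rw [hJlo]
      exact mem_cls_of_reduces (hx i hi') (Finset.filter_subset _ _) hne (reduces_splice_of_le
        (fun l hl => Nat.lt_succ_iff.1 (Finset.mem_filter.1 hl).2) g _)
    · have hJhi : J i = up i := if_neg h
      rw [hJhi] at hne
      change (⟨_, J i, _⟩ : Mark X) ∈ _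
      rw [hJhi]
      exact mem_cls_of_reduces (hx i hi') (Finset.filter_subset _ _) hne (reduces_splice_of_ge
        (Nat.le_succ n) (fun l hl => not_lt.1 (Finset.mem_filter.1 hl).2) (fun _ _ _ => rfl) _)
  · exact hcov (splice n (n + 1) g z) (by simp [splice, g])
  · calc ∑ i ∈ s, wt (x i).level (J i).card ≤ ∑ i ∈ s, 2 * (x i).weight := by
          refine Finset.sum_le_sum fun i hi' => ?_
          refine (weight_restrict_le (hx i hi') (hJ i)).trans ?_
          gcongr
          · exact (x i).weight_nonneg
          · exact rpow_expo_le_two (by norm_num) (by norm_num) _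
      _ ≤ 2 * c := by
          rw [← Finset.mul_sum]
          linarith

end

section

variable {X : ℕ → Type}

/-! ### Heads and tails of marks -/

/-- At least half of the indices of the mark `x` are below `n`. -/
def IsHead (n : ℕ) (x : Mark X) : Prop := x.idx.card ≤ 2 * (x.idx.filter fun l => l < n).card

theorem IsHead.mono {m n : ℕ} (hmn : m ≤ n) {x : Mark X} (h : IsHead m x) : IsHead n x := by
  refine h.trans (Nat.mul_le_mul_left 2 (Finset.card_le_card ?_))
  exact Finset.monotone_filter_right _ fun l _ hl => lt_of_lt_of_le hl hmn

/-- The mark `x` truncated to the first `n` coordinates. -/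
def Mark.head (n : ℕ) (x : Mark X) : Mark X :=
  ⟨x.level, x.idx.filter fun l => l < n, hull n x.carrier⟩

/-- The mark `x` seen from the cylinder of length `n` at `a`. -/
def Mark.tail (n : ℕ) (a : ∀ i, X i) (x : Mark X) : Mark X :=
  ⟨x.level, x.idx.filter fun l => ¬ l < n, {z | graft n a z ∈ x.carrier}⟩

theorem head_mem_cls {d k n : ℕ} {x : Mark X} (hx : x ∈ cls X d k) (h : IsHead n x) :
    x.head n ∈ cls X d k := by
  have h0 := (cls_spec hx).2.1
  refine mem_cls_of_reduces hx (Finset.filter_subset _ _) (Finset.card_pos.1 ?_)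
    (reduces_hull (fun l hl => (Finset.mem_filter.1 hl).2.le) _)
  exact Nat.pos_of_mul_pos_left (h0.trans_le h)

theorem head_weight_le {d k n : ℕ} {x : Mark X} (hx : x ∈ cls X d k) (h : IsHead n x) :
    (x.head n).weight ≤ 2 * x.weight := by
  refine (weight_restrict_le hx h).trans ?_
  gcongr
  · exact x.weight_nonneg
  · exact rpow_expo_le_two (by norm_num) (by norm_num) _

theorem card_le_of_not_isHead {n : ℕ} {x : Mark X} (h : ¬ IsHead n x) :
    x.idx.card ≤ 2 * (x.idx.filter fun l => ¬ l < n).card := by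
  have := Finset.card_filter_add_card_filter_not (s := x.idx) (fun l => l < n)
  unfold IsHead at h
  omega

theorem tail_mem_cls {d k n : ℕ} (a : ∀ i, X i) {x : Mark X} (hx : x ∈ cls X d k)
    (h : ¬ IsHead n x) : x.tail n a ∈ cls X d k := by
  have h0 := (cls_spec hx).2.1
  refine mem_cls_of_reduces hx (Finset.filter_subset _ _) (Finset.card_pos.1 ?_)
    (reduces_graft (fun l hl => not_lt.1 (Finset.mem_filter.1 hl).2) _ _)
  exact Nat.pos_of_mul_pos_left (h0.trans_le (card_le_of_not_isHead h))

theorem tail_weight_le {d k n : ℕ} (a : ∀ i, X i) {x : Mark X} (hx : x ∈ cls X d k)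
    (h : ¬ IsHead n x) : (x.tail n a).weight ≤ 2 * x.weight := by
  refine (weight_restrict_le hx (card_le_of_not_isHead h)).trans ?_
  gcongr
  · exact x.weight_nonneg
  · exact rpow_expo_le_two (by norm_num) (by norm_num) _

open Classical in
theorem sum_tail_weight_le {d k n : ℕ} (a : ∀ i, X i) {ι : Type} {s : Finset ι} {x : ι → Mark X}
    (hx : ∀ i ∈ s, x i ∈ cls X d k) :
    ∑ i ∈ s.filter (fun i => ¬ IsHead n (x i)), ((x i).tail n a).weight ≤
      2 * ∑ i ∈ s, (x i).weight := by
  rw [Finset.mul_sum]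
  refine (Finset.sum_le_sum fun i hi => ?_).trans (Finset.sum_le_sum_of_subset_of_nonneg
    (Finset.filter_subset _ _) fun i _ _ => mul_nonneg zero_le_two (x i).weight_nonneg)
  obtain ⟨hi, h⟩ := Finset.mem_filter.1 hi
  exact tail_weight_le a (hx i hi) h

open Classical in
/-- If a cylinder of length `n` is covered by a light family, then it meets the hull of some head
of the family. -/
theorem exists_isHead_mem_hull [∀ n, Nonempty (X n)] {d k n : ℕ} {ι : Type} {s : Finset ι}
    {x : ι → Mark X} (hx : ∀ i ∈ s, x i ∈ cls X d k) (hw : ∑ i ∈ s, (x i).weight ≤ 8)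
    {a : ∀ i, X i} (hcov : ∀ z, ∃ i ∈ s, graft n a z ∈ (x i).carrier) :
    ∃ i ∈ s, IsHead n (x i) ∧ a ∈ hull n (x i).carrier := by
  by_contra! hcon
  refine not_covers_univ d k (c := 16) le_rfl ⟨ι, s.filter fun i => ¬ IsHead n (x i),
    fun i => (x i).tail n a, fun i hi => ?_, fun z _ => ?_, ?_⟩
  · obtain ⟨hi, h⟩ := Finset.mem_filter.1 hi
    exact tail_mem_cls a (hx i hi) h
  · obtain ⟨i, hi, hz⟩ := hcov z
    exact ⟨i, Finset.mem_filter.2 ⟨hi, fun h => hcon i hi h ⟨_, hz, (agree_graft n a z).symm⟩⟩, hz⟩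
  · have := sum_tail_weight_le (n := n) a hx
    linarith

/-- A set ignoring the first `m` coordinates that is lightly covered is lightly covered by marks
whose carriers ignore the first `m` coordinates. -/
theorem exists_ignoring_cover [∀ n, Nonempty (X n)] {d k m : ℕ} {A : Set (∀ i, X i)}
    (hA : IgnoresFirst m A) (h : Covers (cls X d k) A 1) :
    ∃ (ι : Type) (s : Finset ι) (x : ι → Mark X), (∀ i ∈ s, x i ∈ cls X d k) ∧
      (∀ i ∈ s, IgnoresFirst m (x i).carrier) ∧ (∀ z ∈ A, ∃ i ∈ s, z ∈ (x i).carrier) ∧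
      ∑ i ∈ s, (x i).weight ≤ 2 := by
  classical
  obtain ⟨ι, s, x, hx, hcov, hw⟩ := h
  -- The truncated heads are too light to cover the space. Above a cylinder that they miss, the
  -- tails alone must cover `A`.
  have hb : ∃ b, ∀ i ∈ s, IsHead m (x i) → b ∉ hull m (x i).carrier := by
    by_contra! hcon
    refine not_covers_univ d k (c := 2) (by norm_num) ⟨ι, s.filter fun i => IsHead m (x i),
      fun i => (x i).head m, fun i hi => ?_, fun z _ => ?_, ?_⟩
    · obtain ⟨hi, h⟩ := Finset.mem_filter.1 hi
      exact head_mem_cls (hx i hi) h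
    · obtain ⟨i, hi, h, hz⟩ := hcon z
      exact ⟨i, Finset.mem_filter.2 ⟨hi, h⟩, hz⟩
    · calc _ ≤ ∑ i ∈ s.filter (fun i => IsHead m (x i)), 2 * (x i).weight :=
            Finset.sum_le_sum fun i hi => by
              obtain ⟨hi, h⟩ := Finset.mem_filter.1 hi
              exact head_weight_le (hx i hi) h
        _ ≤ ∑ i ∈ s, 2 * (x i).weight := Finset.sum_le_sum_of_subset_of_nonneg
            (Finset.filter_subset _ _) fun i _ _ => mul_nonneg zero_le_two (x i).weight_nonneg
        _ ≤ 2 := by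
            rw [← Finset.mul_sum]
            linarith
  obtain ⟨b, hb⟩ := hb
  refine ⟨ι, s.filter fun i => ¬ IsHead m (x i), fun i => (x i).tail m b, fun i hi => ?_,
    fun i _ => ignoresFirst_graft m b _, fun z hz => ?_, ?_⟩
  · obtain ⟨hi, h⟩ := Finset.mem_filter.1 hi
    exact tail_mem_cls b (hx i hi) h
  · obtain ⟨i, hi, hz⟩ := hcov _ ((hA b z).2 hz)
    exact ⟨i, Finset.mem_filter.2 ⟨hi, fun h => hb i hi h ⟨_, hz, (agree_graft m b z).symm⟩⟩, hz⟩
  · have := sum_tail_weight_le (n := m) b hx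
    linarith

/-! ### Sets depending on finitely many coordinates -/

theorem finite_range_graft [∀ n, Finite (X n)] (n : ℕ) (p : ∀ i, X i) :
    (Set.range fun a => graft n a p).Finite := by
  refine (Set.finite_range fun (f : ∀ i : Fin n, X i) (i : ℕ) =>
    if h : i < n then f ⟨i, h⟩ else p i).subset ?_
  rintro _ ⟨a, rfl⟩
  exact ⟨fun i => a i, by funext i; by_cases h : i < n <;> simp [graft, h]⟩

theorem finite_dependsOnFirst [∀ n, Finite (X n)] [∀ n, Nonempty (X n)] (n : ℕ) :
    {C : Set (∀ i, X i) | DependsOnFirst n C}.Finite := by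
  let p : ∀ i, X i := fun i => Classical.arbitrary (X i)
  refine Set.Finite.of_finite_image (f := fun C => C ∩ Set.range fun a => graft n a p)
    ((finite_range_graft n p).finite_subsets.subset ?_) ?_
  · rintro _ ⟨C, -, rfl⟩
    exact Set.inter_subset_right
  · have key : ∀ C D : Set (∀ i, X i), DependsOnFirst n C → DependsOnFirst n D →
        (C ∩ Set.range fun a => graft n a p) = (D ∩ Set.range fun a => graft n a p) → C ⊆ D := by
      intro C D hC hD h z hz
      have h1 : graft n z p ∈ C ∩ Set.range fun a => graft n a p :=
        ⟨hC _ _ (agree_graft n z p).symm hz, z, rfl⟩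
      rw [h] at h1
      exact hD _ _ (agree_graft n z p) h1.1
    exact fun C hC D hD h => (key C D hC hD h).antisymm (key D C hD hC h.symm)

/-! ### Passing to the limit along an ultrafilter -/

/-- For most `p`, the marks of levels `k, …, p - 1` cover `A` with total weight at most `c`. -/
def Small (k : ℕ) (A : Set (∀ i, X i)) (c : ℝ) : Prop :=
  ∀ᶠ p in (Filter.hyperfilter ℕ : Filter ℕ), Covers (cls X (p - k) k) A c

theorem eventually_hyperfilter_ge (n : ℕ) : ∀ᶠ p in (Filter.hyperfilter ℕ : Filter ℕ), n ≤ p :=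
  Nat.hyperfilter_le_atTop (Filter.eventually_ge_atTop n)

theorem Small.mono {k : ℕ} {A B : Set (∀ i, X i)} {c d : ℝ} (h : Small k A c) (hA : B ⊆ A)
    (hc : c ≤ d) : Small k B d :=
  Filter.Eventually.mono h fun _ hp => hp.mono subset_rfl hA hc

theorem small_empty (k : ℕ) {c : ℝ} (hc : 0 ≤ c) : Small k (∅ : Set (∀ i, X i)) c :=
  Filter.Eventually.of_forall fun _ => covers_empty _ hc

theorem Small.union {k : ℕ} {A B : Set (∀ i, X i)} {c d : ℝ} (hA : Small k A c)
    (hB : Small k B d) : Small k (A ∪ B) (c + d) :=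
  Filter.Eventually.mp hA (Filter.Eventually.mono hB fun _ hB hA => hA.union hB)

theorem cls_sub_eq {p k : ℕ} (h : k + 1 ≤ p) : cls X (p - k) k = cls X (p - (k + 1) + 1) k := by
  congr 1
  omega

theorem Small.of_succ {k : ℕ} {A : Set (∀ i, X i)} {c : ℝ} (h : Small (k + 1) A c) :
    Small k A c := by
  refine Filter.Eventually.mp h ((eventually_hyperfilter_ge (k + 1)).mono fun p hp h => ?_)
  rw [cls_sub_eq hp]
  exact h.mono Set.subset_union_left subset_rfl le_rfl

theorem Small.zero {k : ℕ} {A : Set (∀ i, X i)} {c : ℝ} (h : Small k A c) : Small 0 A c := by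
  induction k with
  | zero => exact h
  | succ k ih => exact ih h.of_succ

/-- The ultrafilter turns failure of `Small` into failure of covering for most `p`, simultaneously
for the finitely many pairs of indices and cylinders. So `E` itself is an admissible mark of level
`k` for most `p`. -/
theorem small_of_thin [∀ n, Finite (X n)] [∀ n, Nonempty (X n)] {k : ℕ} {I : Finset ℕ}
    (hI : I.Nonempty) (hIk : I.card ≤ cap k)
    {E : Set (∀ i, X i)} (h : ∀ m ∈ I, ∀ n ∈ I, m < n → ∀ a,
      ¬ Small (k + 1) {z | graft m a z ∉ hull n E} 1) : Small k E (wt k I.card) := by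
  have hthin : ∀ᶠ p in (Filter.hyperfilter ℕ : Filter ℕ),
      Thin (cls X (p - (k + 1)) (k + 1)) I E := by
    unfold Thin
    rw [Filter.eventually_all_finset]
    intro m hm
    rw [Filter.eventually_all_finset]
    intro n hn
    by_cases hmn : m < n
    · let p : ∀ i, X i := fun i => Classical.arbitrary (X i)
      have h1 : ∀ᶠ q in (Filter.hyperfilter ℕ : Filter ℕ), ∀ a ∈ Set.range fun a => graft m a p,
          ¬ Covers (cls X (q - (k + 1)) (k + 1)) {z | graft m a z ∉ hull n E} 1 := by
        rw [Filter.eventually_all_finite (finite_range_graft m p)]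
        exact fun a _ => Ultrafilter.eventually_not.2 (h m hm n hn hmn a)
      refine h1.mono fun q hq _ a => ?_
      have h2 := hq _ ⟨a, rfl⟩
      simpa only [graft_congr (agree_graft m a p)] using h2
    · exact Filter.Eventually.of_forall fun _ h' => absurd h' hmn
  refine Filter.Eventually.mp hthin ((eventually_hyperfilter_ge (k + 1)).mono fun p hp hthin => ?_)
  rw [cls_sub_eq hp]
  exact covers_singleton (x := ⟨k, I, E⟩) (Or.inr ⟨rfl, hI, hIk, hthin⟩)

/-- Thinness along a single index is vacuous. -/
theorem small_univ [∀ n, Finite (X n)] [∀ n, Nonempty (X n)] :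
    Small 0 (Set.univ : Set (∀ i, X i)) (wt 0 1) :=
  small_of_thin (I := {0}) (by simp) (cap_pos 0) (by
    intro m hm n hn hmn
    simp only [Finset.mem_singleton] at hm hn
    omega)

theorem not_small_univ [∀ n, Nonempty (X n)] (k : ℕ) {c : ℝ} (hc : c ≤ 16) :
    ¬ Small k (Set.univ : Set (∀ i, X i)) c := fun h => by
  obtain ⟨p, hp⟩ := h.exists
  exact not_covers_univ _ _ hc hp

theorem not_small_slice [∀ n, Nonempty (X n)] (k n : ℕ) (a : X n) {c : ℝ} (hc : c ≤ 8) :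
    ¬ Small k {z : ∀ i, X i | z n = a} c := fun h => by
  obtain ⟨p, hp⟩ := h.exists
  exact not_covers_slice _ _ _ _ hc hp

/-! ### Exhaustivity -/

theorem not_small_hull_anti {k m n n' : ℕ} {a : ∀ i, X i} {G G' : Set (∀ i, X i)}
    (h : ¬ Small k {z | graft m a z ∉ hull n G} 1) (hn : n ≤ n') (hG : G' ⊆ G) :
    ¬ Small k {z | graft m a z ∉ hull n' G'} 1 :=
  fun hs => h (hs.mono (fun _ hz hz' => hz (hull_mono n hG (hull_anti hn _ hz'))) le_rfl)

theorem Small.sdiff_inter {k : ℕ} {A G H : Set (∀ i, X i)} {c d : ℝ} (h : Small k (A \ G) c)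
    (h' : Small k (A \ H) d) : Small k (A \ (G ∩ H)) (c + d) := by
  rw [Set.sdiff_inter]
  exact h.union h'

section

variable [∀ n, Finite (X n)] [∀ n, Nonempty (X n)]

/-- Cover the sets by families of weight at most 2 and let `C` be the union of the `n`-hulls of the
heads, with `n` so large that little weight becomes head later. -/
theorem exists_small_dependsOnFirst {k m : ℕ} {E : ℕ → Set (∀ i, X i)}
    (hE : ∀ i, ∃ n, DependsOnFirst n (E i)) (hm : ∀ i, IgnoresFirst m (E i))
    (h : ∀ r, Small k (⋃ i < r, E i) 1) {ε : ℝ} (hε : 0 < ε) :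
    ∃ n C, m ≤ n ∧ DependsOnFirst n C ∧ IgnoresFirst m C ∧ Small k C 4 ∧
      ∀ i, Small k (E i \ C) ε := by
  classical
  let U : Filter ℕ := (Filter.hyperfilter ℕ : Filter ℕ)
  let good : ℕ → ℕ → Prop := fun p r => ∃ (ι : Type) (s : Finset ι) (x : ι → Mark X),
    (∀ i ∈ s, x i ∈ cls X (p - k) k) ∧ (∀ i ∈ s, IgnoresFirst m (x i).carrier) ∧
    (∀ j < r, ∀ z ∈ E j, ∃ i ∈ s, z ∈ (x i).carrier) ∧ ∑ i ∈ s, (x i).weight ≤ 2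
  have hgood : ∀ r, ∀ᶠ p in U, good p r := by
    refine fun r => Filter.Eventually.mono (h r) fun p hp => ?_
    obtain ⟨ι, s, x, hx, hig, hcov, hw⟩ := exists_ignoring_cover (m := m) (by
      intro a z
      simp only [Set.mem_iUnion, hm _ a z]) hp
    exact ⟨ι, s, x, hx, hig, fun j hj z hz => hcov z (Set.mem_biUnion hj hz), hw⟩
  have hfam : ∀ p, ∃ (ι : Type) (s : Finset ι) (x : ι → Mark X),
      (∀ i ∈ s, x i ∈ cls X (p - k) k) ∧ (∀ i ∈ s, IgnoresFirst m (x i).carrier) ∧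
      (∀ r ≤ p, good p r → ∀ j < r, ∀ z ∈ E j, ∃ i ∈ s, z ∈ (x i).carrier) ∧
      ∑ i ∈ s, (x i).weight ≤ 2 := by
    intro p
    have h0 : good p 0 := ⟨ℕ, ∅, fun _ => ⟨0, ∅, ∅⟩, by simp, by simp, by simp, by simp⟩
    -- Taking the longest initial segment of the sequence that can be covered, up to `p`, makes a
    -- single family per `p` serve every `E j` for most `p`.
    obtain ⟨ι, s, x, hx, hig, hcov, hw⟩ := Nat.findGreatest_spec (P := good p) (Nat.zero_le p) h0
    exact ⟨ι, s, x, hx, hig,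
      fun r hr hgr j hj => hcov j (hj.trans_le (Nat.le_findGreatest hr hgr)), hw⟩
  choose ι s x hx hig hcov hw using hfam
  have hcovE : ∀ j, ∀ᶠ p in U, ∀ z ∈ E j, ∃ i ∈ s p, z ∈ (x p i).carrier := fun j =>
    (hgood (j + 1)).mp ((eventually_hyperfilter_ge (j + 1)).mono fun p hp hg =>
      hcov p (j + 1) hp hg j j.lt_succ_self)
  let f : ℕ → ℕ → ℝ := fun n p => ∑ i ∈ (s p).filter (fun i => IsHead n (x p i)), (x p i).weight
  have hf0 : ∀ n p, 0 ≤ f n p := fun n p => Finset.sum_nonneg fun i _ => (x p i).weight_nonneg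
  have hf2 : ∀ n p, f n p ≤ 2 := fun n p =>
    (Finset.sum_le_sum_of_subset_of_nonneg (Finset.filter_subset _ _)
      fun i _ _ => (x p i).weight_nonneg).trans (hw p)
  let V : Set ℝ := {v | ∃ n, m ≤ n ∧ ∀ᶠ p in U, v ≤ f n p}
  have hVne : V.Nonempty := ⟨0, m, le_rfl, Filter.Eventually.of_forall fun p => hf0 m p⟩
  have hVb : BddAbove V := by
    refine ⟨2, ?_⟩
    rintro v ⟨n, -, hv⟩
    obtain ⟨p, hp⟩ := hv.exists
    exact hp.trans (hf2 n p)
  -- `sSup V` is the supremum over `n` of the ultrafilter limits of the head weights. Beyond this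
  -- `n` they grow by less than `ε / 2` for most `p`.
  obtain ⟨v, ⟨n, hmn, hv⟩, hlt⟩ := exists_lt_of_lt_csSup hVne
    (show sSup V - ε / 4 < sSup V by linarith)
  have hub : ∀ n', m ≤ n' → ∀ᶠ p in U, f n' p < sSup V + ε / 4 := by
    intro n' hn'
    by_contra hcon
    have h1 : ∀ᶠ p in U, ¬ f n' p < sSup V + ε / 4 := Ultrafilter.eventually_not.2 hcon
    have := le_csSup hVb ⟨n', hn', h1.mono fun p hp => not_lt.1 hp⟩
    linarith
  let H : ℕ → Set (∀ i, X i) := fun p =>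
    {z | ∃ i ∈ s p, IsHead n (x p i) ∧ z ∈ hull n (x p i).carrier}
  have hHdep : ∀ p, DependsOnFirst n (H p) := by
    rintro p u v huv ⟨i, hi, hh, hz⟩
    exact ⟨i, hi, hh, dependsOnFirst_hull n _ u v huv hz⟩
  have hHig : ∀ p, IgnoresFirst m (H p) := by
    intro p a z
    constructor
    · rintro ⟨i, hi, hh, hz⟩
      exact ⟨i, hi, hh, ((hig p i hi).hull n a z).1 hz⟩
    · rintro ⟨i, hi, hh, hz⟩
      exact ⟨i, hi, hh, ((hig p i hi).hull n a z).2 hz⟩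
  -- `H p` takes finitely many values, so the ultrafilter selects one.
  obtain ⟨C, hCdep, hC⟩ : ∃ C ∈ {C : Set (∀ i, X i) | DependsOnFirst n C}, ∀ᶠ p in U, H p = C := by
    have h1 : ⋃ C ∈ {C : Set (∀ i, X i) | DependsOnFirst n C}, {p | H p = C} ∈
        Filter.hyperfilter ℕ := by
      refine Filter.mem_of_superset Filter.univ_mem fun p _ => ?_
      simp only [Set.mem_iUnion]
      exact ⟨H p, hHdep p, rfl⟩
    exact (Ultrafilter.finite_biUnion_mem_iff (finite_dependsOnFirst n)).1 h1
  refine ⟨n, C, hmn, hCdep, ?_, ?_, fun j => ?_⟩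
  · obtain ⟨p, hp⟩ := hC.exists
    exact hp ▸ hHig p
  · refine hC.mono fun p hp => ⟨ι p, (s p).filter fun i => IsHead n (x p i),
      fun i => (x p i).head n, fun i hi => ?_, fun z hz => ?_, ?_⟩
    · obtain ⟨hi, hh⟩ := Finset.mem_filter.1 hi
      exact head_mem_cls (hx p i hi) hh
    · rw [← hp] at hz
      obtain ⟨i, hi, hh, hz⟩ := hz
      exact ⟨i, Finset.mem_filter.2 ⟨hi, hh⟩, hz⟩
    · calc _ ≤ ∑ i ∈ (s p).filter (fun i => IsHead n (x p i)), 2 * (x p i).weight :=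
            Finset.sum_le_sum fun i hi => by
              obtain ⟨hi, hh⟩ := Finset.mem_filter.1 hi
              exact head_weight_le (hx p i hi) hh
        _ = 2 * f n p := by rw [← Finset.mul_sum]
        _ ≤ 4 := by linarith [hf2 n p]
  · obtain ⟨nj, hnj⟩ := hE j
    let n' := max n nj
    refine (hC.and ((hcovE j).and (hv.and (hub n' (hmn.trans (le_max_left _ _)))))).mono ?_
    rintro p ⟨hp, hcovp, hvp, hubp⟩
    have hsub : ((s p).filter fun i => IsHead n (x p i)) ⊆
        (s p).filter fun i => IsHead n' (x p i) := by
      intro i hi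
      obtain ⟨hi, hh⟩ := Finset.mem_filter.1 hi
      exact Finset.mem_filter.2 ⟨hi, hh.mono (le_max_left _ _)⟩
    refine ⟨ι p, ((s p).filter fun i => IsHead n' (x p i)) \
      ((s p).filter fun i => IsHead n (x p i)), fun i => (x p i).head n', fun i hi => ?_,
      fun z hz => ?_, ?_⟩
    · obtain ⟨hi, hh⟩ := Finset.mem_filter.1 (Finset.mem_sdiff.1 hi).1
      exact head_mem_cls (hx p i hi) hh
    -- The tails cannot cover a cylinder of length `n'` inside `E j`, so it meets the hull of an
    -- `n'`-head; outside `C` this head is not yet an `n`-head.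
    · obtain ⟨i, hi, hh, hz'⟩ := exists_isHead_mem_hull (n := n') (a := z) (hx p)
        ((hw p).trans (by norm_num)) fun u => hcovp _ (hnj z _
          ((agree_graft n' z u).symm.mono (le_max_right _ _)) hz.1)
      refine ⟨i, Finset.mem_sdiff.2 ⟨Finset.mem_filter.2 ⟨hi, hh⟩, fun h' => hz.2 ?_⟩, hz'⟩
      rw [← hp]
      exact ⟨i, hi, (Finset.mem_filter.1 h').2, hull_anti (le_max_left _ _) _ hz'⟩
    · calc _ ≤ ∑ i ∈ ((s p).filter fun i => IsHead n' (x p i)) \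
            ((s p).filter fun i => IsHead n (x p i)), 2 * (x p i).weight :=
            Finset.sum_le_sum fun i hi => by
              obtain ⟨hi, hh⟩ := Finset.mem_filter.1 (Finset.mem_sdiff.1 hi).1
              exact head_weight_le (hx p i hi) hh
        _ = 2 * (f n' p - f n p) := by
            rw [← Finset.mul_sum, Finset.sum_sdiff_eq_sub hsub]
        _ ≤ ε := by linarith

/-- If all finite unions are cheap in the cylinder at `a`, removing from `E i` what lies there
outside `C` is cheap and confines the rest to `C`. If a finite union is expensive, later terms are
disjoint from it, and so are their hulls at its depth. -/
theorem exists_thin_at {k m : ℕ} {E : ℕ → Set (∀ i, X i)}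
    (hE : ∀ i, ∃ n, DependsOnFirst n (E i)) (hdisj : Pairwise fun i j => Disjoint (E i) (E j))
    {ε : ℝ} (hε : 0 < ε) (a : ∀ i, X i) :
    ∃ n i₀, ∀ i ≥ i₀, ∃ G ⊆ E i, Small k (E i \ G) ε ∧
      ¬ Small k {z | graft m a z ∉ hull n G} 1 := by
  let F : ℕ → Set (∀ i, X i) := fun i => {z | graft m a z ∈ E i}
  by_cases h : ∀ r, Small k (⋃ i < r, F i) 1
  · obtain ⟨n, C, hmn, hCdep, hCig, hC, hEC⟩ := exists_small_dependsOnFirst (E := F) (m := m)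
      (fun i => (hE i).imp fun n hn u v huv => hn _ _ (huv.graft_right a))
      (fun i => ignoresFirst_graft m a _) h hε
    refine ⟨n, 0, fun i _ => ⟨E i \ {u | Agree m u a ∧ u ∉ C}, Set.sdiff_subset,
      (hEC i).mono ?_ le_rfl, fun hs => ?_⟩⟩
    · rintro u ⟨hu, hu'⟩
      have hu'' : Agree m u a ∧ u ∉ C := by
        by_contra hcon
        exact hu' ⟨hu, hcon⟩
      refine ⟨?_, hu''.2⟩
      have : graft m a u = u := by
        funext l
        by_cases hl : l < m
        · simp [graft, hl, hu''.1 l hl]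
        · simp [graft, hl]
      simpa [F, this] using hu
    -- In the cylinder, the hull of `G` lies in `C`; so its complement, at cost 1, and `C`, at cost
    -- 4, would cover the space.
    · refine not_small_univ k (c := 1 + 4) (by norm_num) ((hs.union hC).mono (fun z _ => ?_) le_rfl)
      by_contra hz
      simp only [Set.mem_union, Set.mem_ofPred_eq, not_or, not_not] at hz
      obtain ⟨⟨u, hu, hzu⟩, hzC⟩ := hz
      have huC : u ∈ C := by
        by_contra hcon
        exact hu.2 ⟨(hzu.mono hmn).symm.trans (agree_graft m a z), hcon⟩
      exact hzC ((hCig a z).1 (hCdep _ _ hzu.symm huC))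
  · push Not at h
    obtain ⟨r, hr⟩ := h
    choose nn hnn using hE
    refine ⟨(Finset.range r).sup nn, r, fun i hi => ⟨E i, subset_rfl, ?_, fun hs => hr
      (hs.mono (fun z hz => ?_) le_rfl)⟩⟩
    · rw [Set.sdiff_self]
      exact small_empty k hε.le
    · simp only [Set.mem_iUnion] at hz
      obtain ⟨j, hj, hz⟩ := hz
      rintro ⟨u, hu, hzu⟩
      have h1 : u ∈ E j :=
        hnn j _ _ (hzu.mono (Finset.le_sup (f := nn) (Finset.mem_range.2 hj))) hz
      exact Set.disjoint_left.1 (hdisj (show j ≠ i by omega)) h1 hu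

/-- There are finitely many cylinders of length `m`; they share `ε` equally, and intersecting the
sets `G` preserves what was gained. -/
theorem exists_thin_step {k m : ℕ} {E : ℕ → Set (∀ i, X i)}
    (hE : ∀ i, ∃ n, DependsOnFirst n (E i)) (hdisj : Pairwise fun i j => Disjoint (E i) (E j))
    {ε : ℝ} (hε : 0 < ε) :
    ∃ n > m, ∃ i₀, ∀ i ≥ i₀, ∃ G ⊆ E i, Small k (E i \ G) ε ∧
      ∀ a, ¬ Small k {z | graft m a z ∉ hull n G} 1 := by
  classical
  let p : ∀ i, X i := fun i => Classical.arbitrary (X i)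
  have key : ∀ (P : Finset (∀ i, X i)) (δ : ℝ), 0 < δ →
      ∃ n > m, ∃ i₀, ∀ i ≥ i₀, ∃ G ⊆ E i, Small k (E i \ G) (P.card * δ) ∧
        ∀ a ∈ P, ¬ Small k {z | graft m a z ∉ hull n G} 1 := by
    intro P δ hδ
    induction P using Finset.induction_on with
    | empty => exact ⟨m + 1, Nat.lt_succ_self m, 0, fun i _ => ⟨E i, subset_rfl, by
        rw [Set.sdiff_self]; exact small_empty k (by simp), by simp⟩⟩
    | insert a P ha ih =>
      obtain ⟨n₁, hn₁, i₁, h₁⟩ := ih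
      obtain ⟨n₂, i₂, h₂⟩ := exists_thin_at (k := k) (m := m) hE hdisj hδ a
      refine ⟨max n₁ n₂, lt_max_of_lt_left hn₁, max i₁ i₂, fun i hi => ?_⟩
      obtain ⟨G₁, hG₁, hs₁, ht₁⟩ := h₁ i ((le_max_left _ _).trans hi)
      obtain ⟨G₂, hG₂, hs₂, ht₂⟩ := h₂ i ((le_max_right _ _).trans hi)
      refine ⟨G₁ ∩ G₂, Set.inter_subset_left.trans hG₁, (hs₁.sdiff_inter hs₂).mono subset_rfl ?_,
        fun b hb => ?_⟩
      · rw [Finset.card_insert_of_notMem ha]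
        push_cast
        linarith
      · rcases Finset.mem_insert.1 hb with rfl | hb
        · exact not_small_hull_anti ht₂ (le_max_right _ _) Set.inter_subset_right
        · exact not_small_hull_anti (ht₁ b hb) (le_max_left _ _) Set.inter_subset_left
  let P : Finset (∀ i, X i) := (finite_range_graft m p).toFinset
  have hP : (0 : ℝ) < P.card := by
    exact_mod_cast Finset.card_pos.2 ⟨graft m p p, by simp [P]⟩
  obtain ⟨n, hn, i₀, h⟩ := key P (ε / P.card) (by positivity)
  refine ⟨n, hn, i₀, fun i hi => ?_⟩
  obtain ⟨G, hG, hs, ht⟩ := h i hi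
  refine ⟨G, hG, by rwa [mul_div_cancel₀ _ hP.ne'] at hs, fun a => ?_⟩
  have := ht (graft m a p) (by simp [P])
  simpa only [graft_congr (agree_graft m a p)] using this

/-- The extra endpoint `n` is the next index to join `I`. -/
theorem exists_thin_seq {k : ℕ} {E : ℕ → Set (∀ i, X i)}
    (hE : ∀ i, ∃ n, DependsOnFirst n (E i)) (hdisj : Pairwise fun i j => Disjoint (E i) (E j))
    {ε : ℝ} (hε : 0 < ε) (N : ℕ) :
    ∃ (I : Finset ℕ) (n i₀ : ℕ), I.card = N ∧ (∀ m ∈ I, m < n) ∧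
      ∀ i ≥ i₀, ∃ G ⊆ E i, Small k (E i \ G) (N * ε) ∧
        ∀ m ∈ I, ∀ n' ∈ insert n I, m < n' → ∀ a, ¬ Small k {z | graft m a z ∉ hull n' G} 1 := by
  induction N with
  | zero => exact ⟨∅, 0, 0, rfl, by simp, fun i _ => ⟨E i, subset_rfl, by
      rw [Set.sdiff_self]; exact small_empty k (by simp), by simp⟩⟩
  | succ N ih =>
    obtain ⟨I, n, i₁, hcard, hlt, h₁⟩ := ih
    obtain ⟨n', hn', i₂, h₂⟩ := exists_thin_step (k := k) (m := n) hE hdisj hε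
    have hnI : n ∉ I := fun h => (hlt n h).false
    refine ⟨insert n I, n', max i₁ i₂, by rw [Finset.card_insert_of_notMem hnI, hcard],
      fun m hm => ?_, fun i hi => ?_⟩
    · rcases Finset.mem_insert.1 hm with rfl | hm
      · exact hn'
      · exact (hlt m hm).trans hn'
    · obtain ⟨G₁, hG₁, hs₁, ht₁⟩ := h₁ i ((le_max_left _ _).trans hi)
      obtain ⟨G₂, hG₂, hs₂, ht₂⟩ := h₂ i ((le_max_right _ _).trans hi)
      refine ⟨G₁ ∩ G₂, Set.inter_subset_left.trans hG₁, (hs₁.sdiff_inter hs₂).mono subset_rfl ?_,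
        fun m hm l hl hml a => ?_⟩
      · push_cast
        linarith
      · rcases Finset.mem_insert.1 hm with rfl | hm
        · rcases Finset.mem_insert.1 hl with rfl | hl
          · exact not_small_hull_anti (ht₂ a) le_rfl Set.inter_subset_right
          · rcases Finset.mem_insert.1 hl with rfl | hl
            · exact absurd hml (lt_irrefl _)
            · exact absurd hml (hlt l hl).not_gt
        · rcases Finset.mem_insert.1 hl with rfl | hl
          · exact not_small_hull_anti (ht₁ m hm n (Finset.mem_insert_self _ _) (hlt m hm) a) hn'.le
              Set.inter_subset_left
          · exact not_small_hull_anti (ht₁ m hm l hl hml a) le_rfl Set.inter_subset_left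

theorem exists_forall_ge_small (k : ℕ) {E : ℕ → Set (∀ i, X i)}
    (hE : ∀ i, ∃ n, DependsOnFirst n (E i)) (hdisj : Pairwise fun i j => Disjoint (E i) (E j)) :
    ∃ i₀, ∀ i ≥ i₀, Small 0 (E i) (2 * ((2 : ℝ) ^ k)⁻¹) := by
  have hcap : (0 : ℝ) < cap k := by exact_mod_cast cap_pos k
  -- The `cap k` discarded pieces cost `2⁻ᵏ` in total, as much as the mark of level `k` that
  -- remains.
  obtain ⟨I, n, i₀, hI, -, h⟩ := exists_thin_seq (k := k + 1) hE hdisj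
    (ε := ((2 : ℝ) ^ k)⁻¹ / cap k) (by positivity) (cap k)
  refine ⟨i₀, fun i hi => ?_⟩
  obtain ⟨G, -, hs, ht⟩ := h i hi
  have hG : Small k G (wt k I.card) :=
    small_of_thin (Finset.card_pos.1 (hI ▸ cap_pos k)) hI.le
      fun m hm n' hn' => ht m hm n' (Finset.mem_insert_of_mem hn')
  rw [hI, wt_cap] at hG
  rw [mul_div_cancel₀ _ hcap.ne'] at hs
  refine ((hG.union hs.of_succ).mono (fun z hz => ?_) (by linarith)).zero
  by_cases hzG : z ∈ G
  · exact Or.inl hzG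
  · exact Or.inr ⟨hz, hzG⟩

/-- The points whose coordinates avoid those of `t` along a large finite set form a small set. -/
theorem small_avoiding (k : ℕ) {I : Finset ℕ} (hI : I.card = cap k) (t : ∀ i, X i) :
    Small 0 {z : ∀ i, X i | ∀ i ∈ I, z i ≠ t i} ((2 : ℝ) ^ k)⁻¹ := by
  rw [← wt_cap, ← hI]
  refine (small_of_thin (Finset.card_pos.1 (hI ▸ cap_pos k)) hI.le
    fun m hm n _ hmn a hs => ?_).zero
  -- Points with `m`-th coordinate `t m` lie outside the `n`-hull, and a slice is never cheap.
  refine not_small_slice (k + 1) m (t m) (c := 1) (by norm_num) (hs.mono (fun z hz => ?_) le_rfl)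
  rintro ⟨u, hu, hzu⟩
  apply hu m hm
  rw [← hzu m hmn]
  simpa [graft] using hz

end

end

section

variable {X : ℕ → Type}

/-! ### The submeasure -/

/-- The least cost of covering `A` by marks, in the limit. -/
noncomputable def coveringCost (A : Set (∀ i, X i)) : ℝ≥0 := sInf {c : ℝ≥0 | Small 0 A c}

theorem coveringCost_le {A : Set (∀ i, X i)} {c : ℝ≥0} (h : Small 0 A c) : coveringCost A ≤ c :=
  csInf_le' h

/-- `small_univ` is needed because the infimum of the empty set would be 0. -/
theorem small_of_coveringCost_lt [∀ n, Finite (X n)] [∀ n, Nonempty (X n)] {A : Set (∀ i, X i)}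
    {c : ℝ≥0} (h : coveringCost A < c) : Small 0 A c := by
  obtain ⟨d, hd, hdc⟩ := exists_lt_of_csInf_lt
    ⟨⟨wt 0 1, wt_nonneg 0 1⟩, small_univ.mono (Set.subset_univ A) le_rfl⟩ h
  exact Small.mono hd subset_rfl (by exact_mod_cast hdc.le)

theorem coveringCost_mono [∀ n, Finite (X n)] [∀ n, Nonempty (X n)] {A B : Set (∀ i, X i)}
    (h : A ⊆ B) : coveringCost A ≤ coveringCost B :=
  le_of_forall_gt_imp_ge_of_dense fun _ hc =>
    coveringCost_le ((small_of_coveringCost_lt hc).mono h le_rfl)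

theorem coveringCost_union_le [∀ n, Finite (X n)] [∀ n, Nonempty (X n)] (A B : Set (∀ i, X i)) :
    coveringCost (A ∪ B) ≤ coveringCost A + coveringCost B := by
  refine le_of_forall_pos_le_add fun ε hε => ?_
  have hA : coveringCost A < coveringCost A + ε / 2 := lt_add_of_pos_right _ (half_pos hε)
  have hB : coveringCost B < coveringCost B + ε / 2 := lt_add_of_pos_right _ (half_pos hε)
  calc coveringCost (A ∪ B) ≤ (coveringCost A + ε / 2) + (coveringCost B + ε / 2) :=
        coveringCost_le (by
          have := (small_of_coveringCost_lt hA).union (small_of_coveringCost_lt hB)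
          exact_mod_cast this)
    _ = coveringCost A + coveringCost B + (ε / 2 + ε / 2) := by ring
    _ = _ := by rw [add_halves]

theorem four_le_coveringCost_slice [∀ n, Finite (X n)] [∀ n, Nonempty (X n)] (n : ℕ) (a : X n) :
    4 ≤ coveringCost {z : ∀ i, X i | z n = a} := by
  by_contra! h
  exact not_small_slice 0 n a (by norm_num) (small_of_coveringCost_lt h)

/-! ### Finitely additive measures -/

section

variable {B : Type*} [BooleanAlgebra B] {μ : B → ℝ≥0} {ι : Type*}

theorem IsFinAddMeasure.sum_le (hμ : IsFinAddMeasure μ) {E : ι → B}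
    (hE : Pairwise fun i j => Disjoint (E i) (E j)) (s : Finset ι) :
    ∑ i ∈ s, μ (E i) ≤ μ ⊤ := by
  classical
  have : ∑ i ∈ s, μ (E i) = μ (s.sup E) := by
    induction s using Finset.induction_on with
    | empty => simp [hμ.map_bot]
    | insert a s ha ih =>
      rw [Finset.sum_insert ha, Finset.sup_insert, hμ.add, ih]
      exact Finset.disjoint_sup_right.2 fun i hi => hE (by rintro rfl; exact ha hi)
  rw [this]
  exact hμ.mono _ _ le_top

theorem IsFinAddMeasure.exists_card_mul_le [Fintype ι] [Nonempty ι] (hμ : IsFinAddMeasure μ)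
    {E : ι → B} (hE : Pairwise fun i j => Disjoint (E i) (E j)) :
    ∃ i, Fintype.card ι * μ (E i) ≤ μ ⊤ := by
  obtain ⟨i, hi⟩ := Finite.exists_min fun i => μ (E i)
  refine ⟨i, le_trans ?_ (hμ.sum_le hE Finset.univ)⟩
  rw [← nsmul_eq_mul, ← Finset.card_univ]
  exact Finset.card_nsmul_le_sum _ _ _ fun j _ => hi j

theorem IsSubmeasure.sup_le_sum (hμ : IsSubmeasure μ) (E : ι → B) (s : Finset ι) :
    μ (s.sup E) ≤ ∑ i ∈ s, μ (E i) := by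
  classical
  induction s using Finset.induction_on with
  | empty => simp [hμ.map_bot]
  | insert a s ha ih =>
    rw [Finset.sum_insert ha, Finset.sup_insert]
    exact (hμ.subadd _ _).trans (by gcongr)

theorem IsFinAddMeasure.isUniformlyExhaustive (hμ : IsFinAddMeasure μ) :
    IsUniformlyExhaustive μ := by
  intro ε hε
  obtain ⟨n, hn⟩ := exists_nat_gt (μ ⊤ / ε)
  have hn0 : 0 < n := Nat.pos_of_ne_zero fun h => by simp [h] at hn
  refine ⟨n, fun E hE => ?_⟩
  have : Nonempty (Fin n) := ⟨⟨0, hn0⟩⟩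
  obtain ⟨i, hi⟩ := hμ.exists_card_mul_le hE
  refine ⟨i, ?_⟩
  rw [Fintype.card_fin] at hi
  rw [div_lt_iff₀ hε] at hn
  exact le_of_mul_le_mul_left (hi.trans hn.le) (by exact_mod_cast hn0)

theorem IsAbsolutelyContinuous.isUniformlyExhaustive {ν : B → ℝ≥0}
    (h : IsAbsolutelyContinuous ν μ) (hμ : IsUniformlyExhaustive μ) : IsUniformlyExhaustive ν := by
  intro ε hε
  obtain ⟨α, hα, hαε⟩ := h ε hε
  obtain ⟨n, hn⟩ := hμ α hα
  exact ⟨n, fun E hE => (hn E hE).imp fun i hi => hαε _ hi⟩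

end

/-! ### Transfer to the Cantor set -/

/-- The Cantor set is homeomorphic to the product of the spaces of binary words of each length. -/
theorem nonempty_homeomorph_cantorSet : Nonempty (cantorSet ≃ₜ ∀ n : ℕ, Fin n → Bool) := by
  have : Infinite (Σ n : ℕ, Fin n) :=
    Infinite.of_injective (fun n : ℕ => (⟨n + 1, 0⟩ : Σ n : ℕ, Fin n)) fun a b h => by
      simpa using congrArg Sigma.fst h
  obtain ⟨e⟩ := nonempty_equiv_of_countable (α := ℕ) (β := Σ n : ℕ, Fin n)
  let c : ((Σ n : ℕ, Fin n) → Bool) ≃ₜ ∀ n : ℕ, Fin n → Bool :=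
    { toEquiv := Equiv.piCurry fun _ _ => Bool
      continuous_toFun := continuous_pi fun i => continuous_pi fun j =>
        continuous_apply (⟨i, j⟩ : Σ n : ℕ, Fin n)
      continuous_invFun := continuous_pi fun x =>
        (continuous_apply x.2).comp (continuous_apply x.1) }
  exact ⟨cantorSetHomeomorphNatToBool.trans
    ((Homeomorph.piCongrLeft (Y := fun _ => Bool) e).trans c)⟩

theorem exists_dependsOnFirst_of_isClopen [∀ n, TopologicalSpace (X n)]
    [∀ n, DiscreteTopology (X n)] [∀ n, CompactSpace (X n)] {C : Set (∀ i, X i)}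
    (hC : IsClopen C) : ∃ n, DependsOnFirst n C := by
  have hloc : ∀ z, ∃ n, ∀ u, Agree n u z → (u ∈ C ↔ z ∈ C) := by
    have hopen : ∀ D : Set (∀ i, X i), IsOpen D → ∀ z ∈ D, ∃ n, ∀ u, Agree n u z → u ∈ D := by
      intro D hD z hz
      obtain ⟨_, ⟨x, n, rfl⟩, hzx, hsub⟩ :=
        (PiNat.isTopologicalBasis_cylinders X).exists_subset_of_mem_open hz hD
      exact ⟨n, fun u hu => hsub fun i hi => (hu i hi).trans (hzx i hi)⟩
    intro z
    by_cases hz : z ∈ C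
    · exact (hopen C hC.isOpen z hz).imp fun n hn u hu => iff_of_true (hn u hu) hz
    · exact (hopen Cᶜ hC.compl.isOpen z hz).imp fun n hn u hu => iff_of_false (hn u hu) hz
  choose f hf using hloc
  obtain ⟨t, ht⟩ := CompactSpace.elim_nhds_subcover (fun z => PiNat.cylinder z (f z))
    fun z => (PiNat.isOpen_cylinder X z (f z)).mem_nhds (PiNat.self_mem_cylinder z (f z))
  refine ⟨t.sup f, fun u v huv hu => ?_⟩
  have hmem : u ∈ ⋃ z ∈ t, PiNat.cylinder z (f z) := ht ▸ Set.mem_univ u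
  simp only [Set.mem_iUnion] at hmem
  obtain ⟨z, hz, huz⟩ := hmem
  have huz' : Agree (f z) u z := huz
  exact (hf z v ((huv.symm.mono (Finset.le_sup hz)).trans huz')).2 ((hf z u huz').1 hu)

section

variable {K : Type*} [TopologicalSpace K] (e : K ≃ₜ ∀ n : ℕ, Fin n → Bool)

open TopologicalSpace

/-- The submeasure on the clopen subsets of a space homeomorphic to the product. -/
noncomputable def clopenCost (A : Clopens K) : ℝ≥0 := coveringCost (e.symm ⁻¹' (A : Set K))

/-- The clopen set of the points with a given coordinate. -/
def slice (n : ℕ) (a : Fin n → Bool) : Clopens K :=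
  ⟨e ⁻¹' {z | z n = a}, (isClopen_discrete {a}).preimage
    ((continuous_apply (A := fun n : ℕ => Fin n → Bool) n).comp e.continuous)⟩

theorem mem_slice {n : ℕ} {a : Fin n → Bool} {x : K} : x ∈ slice e n a ↔ e x n = a := Iff.rfl

theorem disjoint_slice {n : ℕ} {a b : Fin n → Bool} (h : a ≠ b) :
    Disjoint (slice e n a) (slice e n b) := by
  rw [disjoint_iff]
  ext x
  simp only [Clopens.coe_inf, Clopens.coe_bot, Set.mem_inter_iff, SetLike.mem_coe, mem_slice,
    Set.mem_empty_iff_false, iff_false, not_and]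
  rintro rfl
  exact h

theorem four_le_clopenCost_slice (n : ℕ) (a : Fin n → Bool) : 4 ≤ clopenCost e (slice e n a) := by
  refine (four_le_coveringCost_slice (X := fun n : ℕ => Fin n → Bool) n a).trans
    (coveringCost_mono fun z hz => ?_)
  change e (e.symm z) n = a
  rw [e.apply_symm_apply]
  exact hz

theorem isSubmeasure_clopenCost : IsSubmeasure (clopenCost e) where
  map_bot := le_antisymm (coveringCost_le (by simpa using small_empty 0 le_rfl)) zero_le
  mono _ _ h := coveringCost_mono (Set.preimage_mono h)
  subadd A C := by
    unfold clopenCost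
    rw [Clopens.coe_sup, Set.preimage_union]
    exact coveringCost_union_le _ _

theorem isExhaustive_clopenCost : IsExhaustive (clopenCost e) := by
  intro E hE
  have hdep : ∀ i, ∃ n, DependsOnFirst n (e.symm ⁻¹' (E i : Set K)) := fun i =>
    exists_dependsOnFirst_of_isClopen ((E i).isClopen.preimage e.symm.continuous)
  have hdisj : Pairwise fun i j =>
      Disjoint (e.symm ⁻¹' (E i : Set K)) (e.symm ⁻¹' (E j : Set K)) := fun i j hij => by
    refine Disjoint.preimage _ ?_
    have := (hE hij).eq_bot
    rw [Set.disjoint_iff_inter_eq_empty, ← Clopens.coe_inf, this, Clopens.coe_bot]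
  rw [tendsto_order]
  refine ⟨fun a ha => absurd ha not_lt_zero, fun ε hε => ?_⟩
  obtain ⟨k, hk⟩ := exists_pow_lt_of_lt_one (half_pos hε) (show (2 : ℝ≥0)⁻¹ < 1 by
    exact inv_lt_one_of_one_lt₀ one_lt_two)
  obtain ⟨i₀, hi₀⟩ := exists_forall_ge_small k hdep hdisj
  filter_upwards [Filter.eventually_ge_atTop i₀] with i hi
  refine lt_of_le_of_lt (coveringCost_le (c := 2 * (2 ^ k)⁻¹) (by exact_mod_cast hi₀ i hi)) ?_
  rw [inv_pow] at hk
  calc 2 * ((2 : ℝ≥0) ^ k)⁻¹ < 2 * (ε / 2) := by gcongr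
    _ = ε := mul_div_cancel₀ _ two_ne_zero

theorem not_isUniformlyExhaustive_clopenCost : ¬ IsUniformlyExhaustive (clopenCost e) := by
  intro h
  obtain ⟨n, hn⟩ := h 1 one_pos
  -- The `n` words with a single `true` letter give `n` disjoint slices.
  obtain ⟨i, hi⟩ := hn (fun i => slice e n fun j => decide (j = i)) fun i j hij =>
    disjoint_slice e fun h => hij (by simpa using congrFun h i)
  have := (four_le_clopenCost_slice e n _).trans hi
  norm_num at this

theorem clopenCost_compl_sup_slice_le (k : ℕ) {I : Finset ℕ} (hI : I.card = cap k)
    (t : ∀ n : ℕ, Fin n → Bool) :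
    clopenCost e (I.sup fun n => slice e n (t n))ᶜ ≤ (2 ^ k)⁻¹ := by
  refine coveringCost_le ?_
  have := small_avoiding (X := fun n : ℕ => Fin n → Bool) k hI t
  refine this.mono (fun z hz i hi hzi => hz ?_) (by simp)
  have hle : slice e i (t i) ≤ I.sup fun n => slice e n (t n) :=
    Finset.le_sup (f := fun n => slice e n (t n)) hi
  refine hle ?_
  change e (e.symm z) i = t i
  rw [e.apply_symm_apply]
  exact hzi

/-- The union `S` of lightest slices carries at most half of the mass and its complement is cheap,
so `μ ⊤ ≤ μ ⊤ / 2 + ε / 2`. -/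
theorem eq_zero_of_isAbsolutelyContinuous_clopenCost {μ : Clopens K → ℝ≥0}
    (hμ : IsFinAddMeasure μ) (h : IsAbsolutelyContinuous μ (clopenCost e)) : μ = 0 := by
  have htop : μ ⊤ = 0 := by
    refine le_antisymm (le_of_forall_pos_le_add fun ε hε => ?_) zero_le
    obtain ⟨α, hα, hαε⟩ := h (ε / 2) (half_pos hε)
    obtain ⟨k, hk⟩ := exists_pow_lt_of_lt_one hα (show (2 : ℝ≥0)⁻¹ < 1 by
      exact inv_lt_one_of_one_lt₀ one_lt_two)
    rw [inv_pow] at hk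
    have hpick : ∀ n : ℕ, ∃ a : Fin n → Bool, (2 : ℝ≥0) ^ n * μ (slice e n a) ≤ μ ⊤ := by
      intro n
      obtain ⟨a, ha⟩ := hμ.exists_card_mul_le (E := slice e n) fun a b hab => disjoint_slice e hab
      exact ⟨a, by simpa using ha⟩
    choose t ht using hpick
    -- From `M` on, a lightest slice has mass at most `μ ⊤ / 2 ^ M`, and `2 * cap k ≤ 2 ^ M`.
    let M := cap k + 1
    let I := Finset.Ico M (M + cap k)
    let S := I.sup fun n => slice e n (t n)
    have hI : I.card = cap k := by simp [I]
    have hsum : 2 * μ S ≤ μ ⊤ := by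
      have h1 : ∀ n ∈ I, μ (slice e n (t n)) ≤ μ ⊤ / 2 ^ M := by
        intro n hn
        rw [le_div_iff₀ (by positivity), mul_comm]
        refine le_trans ?_ (ht n)
        gcongr
        · exact one_le_two
        · exact (Finset.mem_Ico.1 hn).1
      have h2 : μ S ≤ cap k * (μ ⊤ / 2 ^ M) := by
        rw [← hI, ← nsmul_eq_mul]
        exact (hμ.sup_le_sum _ I).trans (Finset.sum_le_card_nsmul _ _ _ h1)
      have h3 : (2 : ℝ≥0) * cap k ≤ 2 ^ M := by
        have : 2 * cap k ≤ 2 ^ M := by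
          rw [pow_succ, mul_comm]
          exact Nat.mul_le_mul_right 2 Nat.lt_two_pow_self.le
        exact_mod_cast this
      calc 2 * μ S ≤ 2 * (cap k * (μ ⊤ / 2 ^ M)) := by gcongr
        _ = (2 * cap k) * (μ ⊤ / 2 ^ M) := by ring
        _ ≤ 2 ^ M * (μ ⊤ / 2 ^ M) := by gcongr
        _ = μ ⊤ := mul_div_cancel₀ _ (by positivity)
    have hcompl : μ Sᶜ ≤ ε / 2 := hαε _ ((clopenCost_compl_sup_slice_le e k hI t).trans hk.le)
    have hadd : μ ⊤ ≤ μ S + μ Sᶜ := by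
      have := hμ.subadd S Sᶜ
      rwa [sup_compl_eq_top] at this
    rw [← NNReal.coe_le_coe] at hsum hcompl hadd ⊢
    push_cast at *
    linarith
  funext A
  exact le_antisymm ((hμ.mono A ⊤ le_top).trans htop.le) zero_le

end

end

end Maharam

theorem theorem1p1 :
    ∃ ν : TopologicalSpace.Clopens cantorSet → ℝ≥0,
      Maharam.IsSubmeasure ν ∧
      ν ≠ 0 ∧
      Maharam.IsExhaustive ν ∧
      ¬ Maharam.IsUniformlyExhaustive ν ∧
      (∀ μ : TopologicalSpace.Clopens cantorSet → ℝ≥0,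
        Maharam.IsFinAddMeasure μ → ¬ Maharam.IsAbsolutelyContinuous ν μ) ∧
      (∀ μ : TopologicalSpace.Clopens cantorSet → ℝ≥0,
        Maharam.IsFinAddMeasure μ → Maharam.IsAbsolutelyContinuous μ ν → μ = 0) := by
  obtain ⟨e⟩ := Maharam.nonempty_homeomorph_cantorSet
  refine ⟨Maharam.clopenCost e, Maharam.isSubmeasure_clopenCost e, fun h => ?_,
    Maharam.isExhaustive_clopenCost e, Maharam.not_isUniformlyExhaustive_clopenCost e,
    fun μ hμ h => Maharam.not_isUniformlyExhaustive_clopenCost e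
      (h.isUniformlyExhaustive hμ.isUniformlyExhaustive),
    fun μ hμ h => Maharam.eq_zero_of_isAbsolutelyContinuous_clopenCost e hμ h⟩
  have := Maharam.four_le_clopenCost_slice e 0 Fin.elim0
  rw [h] at this
  norm_num at this
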